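/- Let $d\in\{1,2,3\}$ and let $\Omega\subset\mathbb R^d$ be a bounded domain (an interval if $d=1$, polygonal if $d=2$, polyhedral if $d=3$). Let $\nu>0$, $y_d\in L^2(\Omega)$, $u_d\in L^\infty(\Omega)$, and $a(y,v)=\int_\Omega\nabla y\cdot\nabla v\,dx$ for $y,v\in H_0^1(\Omega)$. Write $(\cdot,\cdot)$ for the inner product of $L^2(\Omega)$ and $$J(y,u)=\tfrac12\|y-y_d\|_{L^2(\Omega)}^2+\tfrac\nu2\|u-u_d\|_{L^2(\Omega)}^2 .$$ For a closed subspace $V\subset H_0^1(\Omega)$ and $u\in L^2(\Omega)$ let $S_V(u)\in V$ be the unique $y\in V$ with $$a(y,v-y)+\|v\|_{L^1(\Omega)}-\|y\|_{L^1(\Omega)}\ \ge\ (u,v-y)\qquad\text{for all } v\in V .$$ Put $f(u)=J(S_{H_0^1(\Omega)}(u),u)$ for $u\in L^2(\Omega)$. Let $\{\mathcal T_h\}$ be a family of conforming simplicial meshes of $\Omega$ with mesh widths $h=\max_{T\in\mathcal T_h}\operatorname{diam}T\to0$: each $\mathcal T_h$ is a finite set of simplices whose closures have union $\bar\Omega$,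 and the closures of any two of them intersect in the convex hull of their common vertices. Assume that the family is shape-regular and quasi-uniform, i.e. there is $\rho>0$, independent of $h$, such that every $T\in\mathcal T_h$ contains a ball of radius $\rho\operatorname{diam}T$ and a ball of radius $\rho h$. Let $V_h$ be the space of all $v\in H_0^1(\Omega)$ such that $v|_T$ is a polynomial of degree at most one for every $T\in\mathcal T_h$, and put $f_h(u)=J(S_{V_h}(u),u)$ for $u\in L^2(\Omega)$. Problem $(P_h)$ is the minimization of $f_h$ over $L^2(\Omega)$, and a local solution of $(P_h)$ is a local minimizer of $f_h$ with respect to the $L^2(\Omega)$-norm. Let $\bar u\in L^2(\Omega)$ satisfy the quadratic growth condition: there are $\varepsilon,\delta>0$ such that $$f(\bar u)\le f(u)-\delta\|u-\bar u\|_{L^2(\Omega)}^2\qquad\text{for all } u\in B_\varepsilon(\bar u):=\{u\in L^2(\Omega):\|u-\bar u\|_{L^2(\Omega)}\le\varepsilon\}.$$ Then for every mesh of the family the localized problem $$\min_{u\in B_\varepsilon(\bar u)} f_h(u)$$ has a global minimizer, and there are local solutions $\bar u_h$ of $(P_h)$, one for every mesh of the family, such that $\bar u_h\to\bar u$ in $L^2(\Omega)$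 as $h\to0$ and, for all sufficiently small $h$, $\bar u_h$ is a global minimizer of the localized problem. -/

import Mathlib

open MeasureTheory Filter Topology Set
open scoped ContDiff RealInnerProductSpace

noncomputable section

namespace VIControl

/-- `ℝ^d` with its Euclidean norm. -/
abbrev Eucl (d : ℕ) : Type := EuclideanSpace ℝ (Fin d)

/-- The real Hilbert space `L²(Ω)`. -/
abbrev L2 {d : ℕ} (Ω : Set (Eucl d)) : Type := Lp ℝ 2 (volume.restrict Ω)

/-- The real Hilbert space `L²(Ω; ℝ^d)`. -/
abbrev L2Vec {d : ℕ} (Ω : Set (Eucl d)) : Type := Lp (Eucl d) 2 (volume.restrict Ω)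

/-- Pairs `(y, g)` with `y ∈ L²(Ω)` and `g ∈ L²(Ω; ℝ^d)`, with the Hilbert norm
`(‖y‖² + ‖g‖²)^{1/2}`; on pairs `(y, ∇y)` this is the norm of `H¹(Ω)`. -/
abbrev GradPair {d : ℕ} (Ω : Set (Eucl d)) : Type := WithLp 2 (L2 Ω × L2Vec Ω)

/-- The pairs `(φ, ∇φ)` for `φ ∈ C_c^∞(Ω)`. -/
def testPairs {d : ℕ} (Ω : Set (Eucl d)) : Submodule ℝ (GradPair Ω) where
  carrier := {p | ∃ φ : Eucl d → ℝ, ContDiff ℝ ∞ φ ∧ HasCompactSupport φ ∧ tsupport φ ⊆ Ω ∧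
    p.fst =ᵐ[volume.restrict Ω] φ ∧ p.snd =ᵐ[volume.restrict Ω] gradient φ}
  zero_mem' := by
    refine ⟨0, contDiff_const, HasCompactSupport.zero, by simp [tsupport], ?_, ?_⟩
    · exact Lp.coeFn_zero _ _ _
    · refine (Lp.coeFn_zero _ _ _).trans (Eventually.of_forall fun x => ?_)
      simp [gradient]
  add_mem' := by
    rintro p q ⟨φ, h1, h2, h3, h4, h5⟩ ⟨ψ, k1, k2, k3, k4, k5⟩
    refine ⟨φ + ψ, h1.add k1, h2.add k2,
      (tsupport_add φ ψ).trans (union_subset h3 k3), ?_, ?_⟩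
    · exact (Lp.coeFn_add p.fst q.fst).trans (h4.add k4)
    · refine (Lp.coeFn_add p.snd q.snd).trans ((h5.add k5).trans (Eventually.of_forall fun x => ?_))
      have e1 : DifferentiableAt ℝ φ x := (h1.differentiable (by simp)) x
      have e2 : DifferentiableAt ℝ ψ x := (k1.differentiable (by simp)) x
      simp [gradient, fderiv_add e1 e2]
  smul_mem' := by
    rintro c p ⟨φ, h1, h2, h3, h4, h5⟩
    refine ⟨c • φ, contDiff_const.smul h1, h2.smul_left (f := fun _ => c),
      (closure_mono (Function.support_const_smul_subset c φ)).trans h3, ?_, ?_⟩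
    · exact (Lp.coeFn_smul c p.fst).trans (h4.const_smul c)
    · refine (Lp.coeFn_smul c p.snd).trans ((h5.const_smul c).trans
        (Eventually.of_forall fun x => ?_))
      have e1 : DifferentiableAt ℝ φ x := (h1.differentiable (by simp)) x
      simp [gradient, fderiv_const_smul e1]

/-- `H₀¹(Ω)`: the closure of `C_c^∞(Ω)` in the norm of `H¹(Ω)`. Its elements are written as pairs
`(y, ∇y)` of a function and its weak gradient, as subspace of `L²(Ω) × L²(Ω; ℝ^d)`. -/
def H10 {d : ℕ} (Ω : Set (Eucl d)) : Submodule ℝ (GradPair Ω) :=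
  (testPairs Ω).topologicalClosure

/-- The bilinear form `a(y, v) = (∇y, ∇v)_{L²(Ω)}`. -/
def bilin {d : ℕ} {Ω : Set (Eucl d)} (y v : GradPair Ω) : ℝ := ⟪y.snd, v.snd⟫

/-- The norm of `L¹(Ω)` of the function `v`. -/
def normL1 {d : ℕ} {Ω : Set (Eucl d)} (v : GradPair Ω) : ℝ := ∫ x in Ω, |v.fst x|

/-- `y ∈ V` solves the variational inequality of the second kind on the subspace `V`:
`a(y, v - y) + ‖v‖_{L¹} - ‖y‖_{L¹} ≥ (u, v - y)` for all `v ∈ V`. -/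
def SolvesVI {d : ℕ} {Ω : Set (Eucl d)} (V : Submodule ℝ (GradPair Ω)) (u : L2 Ω)
    (y : GradPair Ω) : Prop :=
  y ∈ V ∧ ∀ v ∈ V, ⟪u, (v - y).fst⟫ ≤ bilin y (v - y) + normL1 v - normL1 y

open scoped Classical in
/-- The control-to-state operator on `V`: the solution of the variational inequality for `u`
(for `V = H₀¹(Ω)` and its closed subspaces it exists and is unique if `Ω` is bounded, `d ≥ 1`). -/
def solOp {d : ℕ} {Ω : Set (Eucl d)} (V : Submodule ℝ (GradPair Ω)) (u : L2 Ω) : GradPair Ω :=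
  if h : ∃ y, SolvesVI V u y then h.choose else 0

/-- The objective `J(y, u) = ½ ‖y - y_d‖² + (ν / 2) ‖u - u_d‖²`, with norms of `L²(Ω)`. -/
def cost {d : ℕ} {Ω : Set (Eucl d)} (ν : ℝ) (yd ud : L2 Ω) (y : GradPair Ω) (u : L2 Ω) : ℝ :=
  1 / 2 * ‖y.fst - yd‖ ^ 2 + ν / 2 * ‖u - ud‖ ^ 2

/-- The reduced objective `u ↦ J(S_V(u), u)`. -/
def reduced {d : ℕ} {Ω : Set (Eucl d)} (V : Submodule ℝ (GradPair Ω)) (ν : ℝ) (yd ud : L2 Ω)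
    (u : L2 Ω) : ℝ :=
  cost ν yd ud (solOp V u) u

/-- A simplicial mesh of `Ω`. A simplex is given by the set of its `d + 1` vertices; the closed
simplices cover `closure Ω` exactly, and two of them meet at most in a common face. -/
structure Mesh {d : ℕ} (Ω : Set (Eucl d)) where
  elements : Finset (Finset (Eucl d))
  card_eq : ∀ s ∈ elements, s.card = d + 1
  affineIndependent : ∀ s ∈ elements, AffineIndependent ℝ ((↑) : s → Eucl d)
  covers : closure Ω = ⋃ s ∈ elements, convexHull ℝ (s : Set (Eucl d))
  conforming : ∀ s ∈ elements, ∀ t ∈ elements,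
    convexHull ℝ (s : Set (Eucl d)) ∩ convexHull ℝ (t : Set (Eucl d)) ⊆
      convexHull ℝ ((s : Set (Eucl d)) ∩ (t : Set (Eucl d)))

/-- The diameter `h_T` of the simplex with vertex set `s`. -/
def simplexDiam {d : ℕ} (s : Finset (Eucl d)) : ℝ := Metric.diam (convexHull ℝ (s : Set (Eucl d)))

/-- The mesh width `h = max_T h_T`. -/
def Mesh.width {d : ℕ} {Ω : Set (Eucl d)} (T : Mesh Ω) : ℝ :=
  sSup (simplexDiam '' (T.elements : Set (Finset (Eucl d))))

/-- A family of meshes is shape-regular: every simplex `T` contains a ball of radius `ρ h_T`,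
with `ρ > 0` independent of `T` and of the mesh. -/
def ShapeRegular {d : ℕ} {Ω : Set (Eucl d)} {ι : Type*} (T : ι → Mesh Ω) : Prop :=
  ∃ ρ > 0, ∀ i, ∀ s ∈ (T i).elements, ∃ x : Eucl d,
    Metric.closedBall x (ρ * simplexDiam s) ⊆ convexHull ℝ (s : Set (Eucl d))

/-- A family of meshes is quasi-uniform: every simplex of a mesh of width `h` contains a ball of
radius `ρ h`, with `ρ > 0` independent of the simplex and of the mesh. -/
def QuasiUniform {d : ℕ} {Ω : Set (Eucl d)} {ι : Type*} (T : ι → Mesh Ω) : Prop :=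
  ∃ ρ > 0, ∀ i, ∀ s ∈ (T i).elements, ∃ x : Eucl d,
    Metric.closedBall x (ρ * (T i).width) ⊆ convexHull ℝ (s : Set (Eucl d))

/-- The finite element space `V_h`: the functions in `H₀¹(Ω)` that coincide almost everywhere on
each simplex of the mesh with a polynomial of degree at most one. -/
def Mesh.space {d : ℕ} {Ω : Set (Eucl d)} (T : Mesh Ω) : Submodule ℝ (GradPair Ω) where
  carrier := {v | v ∈ H10 Ω ∧ ∀ s ∈ T.elements, ∃ g : Eucl d →ᵃ[ℝ] ℝ,
    ∀ᵐ x ∂(volume.restrict Ω), x ∈ convexHull ℝ (s : Set (Eucl d)) → v.fst x = g x}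
  zero_mem' := by
    refine ⟨zero_mem _, fun s _ => ⟨0, ?_⟩⟩
    filter_upwards [Lp.coeFn_zero ℝ 2 (volume.restrict Ω)] with x hx _
    exact hx
  add_mem' := by
    rintro p q ⟨hp, hp'⟩ ⟨hq, hq'⟩
    refine ⟨add_mem hp hq, fun s hs => ?_⟩
    obtain ⟨g, hg⟩ := hp' s hs
    obtain ⟨k, hk⟩ := hq' s hs
    refine ⟨g + k, ?_⟩
    filter_upwards [hg, hk, Lp.coeFn_add p.fst q.fst] with x h1 h2 h3 hx
    have : (p + q).fst x = p.fst x + q.fst x := h3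
    rw [this, h1 hx, h2 hx]
    rfl
  smul_mem' := by
    rintro c p ⟨hp, hp'⟩
    refine ⟨Submodule.smul_mem _ c hp, fun s hs => ?_⟩
    obtain ⟨g, hg⟩ := hp' s hs
    refine ⟨c • g, ?_⟩
    filter_upwards [hg, Lp.coeFn_smul c p.fst] with x h1 h3 hx
    have : (c • p).fst x = c • p.fst x := h3
    rw [this, h1 hx]
    rfl

/-- Quadratic growth of `F` at `ubar` with radius `ε` and constant `δ`. -/
def QuadraticGrowth {d : ℕ} {Ω : Set (Eucl d)} (F : L2 Ω → ℝ) (ubar : L2 Ω) (ε δ : ℝ) : Prop :=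
  ∀ u ∈ Metric.closedBall ubar ε, F ubar ≤ F u - δ * ‖u - ubar‖ ^ 2

/-- `u` is a global minimizer of `F` over the closed ball of radius `ε` around `ubar`. -/
def SolvesLocalized {d : ℕ} {Ω : Set (Eucl d)} (F : L2 Ω → ℝ) (ubar : L2 Ω) (ε : ℝ)
    (u : L2 Ω) : Prop :=
  u ∈ Metric.closedBall ubar ε ∧ IsMinOn F (Metric.closedBall ubar ε) u

end VIControl

end

open VIControl

open MeasureTheory Filter Topology Set
open scoped ContDiff RealInnerProductSpace

noncomputable section

/-! Two facts carry the proof: the discrete reduced objectives $f_h$ converge to $f$ uniformly on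
bounded sets, and each discrete problem is finite-dimensional in disguise. If $v_h$ minimizes $f_h$
over $B_\varepsilon(\bar u)$, quadratic growth gives $\delta\|v_h-\bar u\|^2\le
(f-f_h)(v_h)+(f_h-f)(\bar u)\to0$. Eventually $v_h$ lies in the open ball and is therefore a local
minimizer of $f_h$.

Uniform convergence (`eventually_forall_norm_solOp_sub_lt`) combines pointwise convergence with
compactness. For a fixed control, the discrete state minimizes the energy over $V_h$, so its error
is bounded by an energy gap. This gap vanishes because nodal interpolants of test functions make the
spaces $V_h$ dense in the limit (`eventually_exists_mem_space_near`). Compactness enters as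
finite-rank approximation: a finite-dimensional $X\subset L^2$ satisfies $\|v-P_Xv\|\le\tau\|\nabla
v\|$ on $H_0^1$ (`exists_finiteDimensional_approx`). Since the state depends on $u$ only through
$(u,\cdot)$ on $V$, replacing $u$ by $P_Xu$ costs $O(\tau)\|u\|$, with the same constant for all
closed $V\subset H_0^1$. A finite net in a ball of $X$ then reduces the uniform statement to
finitely many controls.

Existence of discrete minimizers (`exists_solvesLocalized`) needs no weak compactness: projecting a
control onto the span of the piecewise affine functions, $\bar u$ and $u_d$ keeps the state and does
not increase the cost or the distance to $\bar u$. -/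

namespace VIControl

/-! ### Minimization under uniform midpoint convexity -/

section Minimization

variable {H : Type*} [NormedAddCommGroup H] [CompleteSpace H]

/-- A continuous function that is bounded below and uniformly midpoint convex on a closed set
attains its minimum. -/
theorem exists_isMinOn_of_uniform_midpoint {F : H → ℝ} (hF : Continuous F) {K : Set H}
    (hK : IsClosed K) (hne : K.Nonempty) {c m : ℝ} (hc : 0 < c) (hm : ∀ x ∈ K, m ≤ F x)
    (hmid : ∀ x ∈ K, ∀ y ∈ K, ∃ z ∈ K, F z ≤ (F x + F y) / 2 - c * ‖x - y‖ ^ 2) :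
    ∃ x ∈ K, IsMinOn F K x := by
  set I := sInf (F '' K) with hI
  have hbdd : BddBelow (F '' K) := ⟨m, by rintro _ ⟨x, hx, rfl⟩; exact hm x hx⟩
  have hle : ∀ x ∈ K, I ≤ F x := fun x hx => csInf_le hbdd (mem_image_of_mem F hx)
  have hex : ∀ n : ℕ, ∃ x ∈ K, F x < I + 1 / ((n : ℝ) + 1) := by
    intro n
    obtain ⟨_, ⟨x, hx, rfl⟩, hlt⟩ := exists_lt_of_csInf_lt (hne.image F)
      (lt_add_of_pos_right I (Nat.one_div_pos_of_nat (α := ℝ) (n := n)))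
    exact ⟨x, hx, hlt⟩
  choose x hxK hxF using hex
  have hdist : ∀ n k, n ≤ k → ‖x n - x k‖ ^ 2 ≤ (1 / ((n : ℝ) + 1)) / c := by
    intro n k hnk
    -- Since `F z` is at least the infimum, midpoint convexity turns near-minimality of both points
    -- into closeness: a minimizing sequence is Cauchy.
    obtain ⟨z, hz, hzF⟩ := hmid _ (hxK n) _ (hxK k)
    have h1 := hle z hz
    have h2 := hxF n
    have h3 := hxF k
    have h4 : 1 / ((k : ℝ) + 1) ≤ 1 / ((n : ℝ) + 1) := Nat.one_div_le_one_div hnk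
    rw [le_div_iff₀ hc]
    nlinarith
  have hlim : Tendsto (fun n : ℕ => Real.sqrt ((1 / ((n : ℝ) + 1)) / c)) atTop (𝓝 0) := by
    have := (tendsto_one_div_add_atTop_nhds_zero_nat (𝕜 := ℝ)).div_const c
    simpa [Function.comp_def] using (Real.continuous_sqrt.tendsto _).comp this
  have hcauchy : CauchySeq x := by
    refine cauchySeq_of_le_tendsto_0' (fun n : ℕ => Real.sqrt ((1 / ((n : ℝ) + 1)) / c))
      (fun n k hnk => ?_) hlim
    rw [dist_eq_norm]
    exact Real.le_sqrt_of_sq_le (hdist n k hnk)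
  obtain ⟨y, hy⟩ := cauchySeq_tendsto_of_complete hcauchy
  have hyK : y ∈ K := hK.mem_of_tendsto hy (Eventually.of_forall hxK)
  refine ⟨y, hyK, fun v hv => ?_⟩
  have hup : Tendsto (fun n : ℕ => I + 1 / ((n : ℝ) + 1)) atTop (𝓝 I) := by
    simpa using (tendsto_one_div_add_atTop_nhds_zero_nat (𝕜 := ℝ)).const_add I
  have : F y ≤ I := le_of_tendsto_of_tendsto' ((hF.tendsto y).comp hy) hup fun n => (hxF n).le
  exact this.trans (hle v hv)

end Minimization

/-! ### The variational inequality and its energy -/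

section Variational

variable {d : ℕ} {Ω : Set (Eucl d)}

theorem norm_sq_gradPair (v : GradPair Ω) : ‖v‖ ^ 2 = ‖v.fst‖ ^ 2 + ‖v.snd‖ ^ 2 :=
  WithLp.prod_norm_sq_eq_of_L2 v

theorem continuous_gradPair_fst : Continuous fun v : GradPair Ω => v.fst :=
  (WithLp.continuous_fst 2 _ _)

theorem continuous_gradPair_snd : Continuous fun v : GradPair Ω => v.snd :=
  (WithLp.continuous_snd 2 _ _)

theorem normL1_nonneg (v : GradPair Ω) : 0 ≤ normL1 v :=
  integral_nonneg fun _ => abs_nonneg _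

theorem normL1_zero : normL1 (0 : GradPair Ω) = 0 := by
  unfold normL1
  rw [integral_eq_zero_of_ae]
  filter_upwards [Lp.coeFn_zero ℝ 2 (volume.restrict Ω)] with x hx
  have h : (0 : GradPair Ω).fst x = 0 := hx
  change |(0 : GradPair Ω).fst x| = 0
  rw [h, abs_zero]

/-- On a set of finite measure the `L¹` norm is the `L²` pairing of the absolute value with the
constant one, and the lattice operations of `L²` are continuous. -/
theorem continuous_normL1 [IsFiniteMeasure (volume.restrict Ω)] :
    Continuous (normL1 : GradPair Ω → ℝ) := by
  set one : L2 Ω := Lp.const 2 (volume.restrict Ω) (1 : ℝ) with hone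
  have key : (normL1 : GradPair Ω → ℝ) = fun v => ⟪one, v.fst ⊔ -v.fst⟫ := by
    funext v
    rw [L2.inner_def]
    refine integral_congr_ae ?_
    filter_upwards [Lp.coeFn_const (p := 2) (μ := volume.restrict Ω) (1 : ℝ),
      Lp.coeFn_abs v.fst] with x h1 h2
    have h3 : (v.fst ⊔ -v.fst) x = |v.fst x| := h2
    rw [h3, hone, h1]
    simp
  rw [key]
  have := (continuous_gradPair_fst (Ω := Ω)).sup (continuous_gradPair_fst (Ω := Ω)).neg
  exact continuous_const.inner this

theorem normL1_convex [IsFiniteMeasure (volume.restrict Ω)] (v w : GradPair Ω) {a b : ℝ}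
    (ha : 0 ≤ a) (hb : 0 ≤ b) :
    normL1 (a • v + b • w) ≤ a * normL1 v + b * normL1 w := by
  have hv : Integrable (fun x => |v.fst x|) (volume.restrict Ω) :=
    ((Lp.memLp v.fst).integrable (by norm_num)).abs
  have hw : Integrable (fun x => |w.fst x|) (volume.restrict Ω) :=
    ((Lp.memLp w.fst).integrable (by norm_num)).abs
  unfold normL1
  rw [← integral_const_mul, ← integral_const_mul, ← integral_add (hv.const_mul a) (hw.const_mul b)]
  refine integral_mono_ae ((Lp.memLp _).integrable (by norm_num)).abs
    ((hv.const_mul a).add (hw.const_mul b)) ?_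
  filter_upwards [Lp.coeFn_add (a • v.fst) (b • w.fst), Lp.coeFn_smul a v.fst,
    Lp.coeFn_smul b w.fst] with x h1 h2 h3
  have : (a • v + b • w).fst x = a * v.fst x + b * w.fst x := by
    have h4 : (a • v + b • w).fst x = (a • v.fst + b • w.fst) x := rfl
    rw [h4, h1, Pi.add_apply, h2, h3]
    rfl
  simp only [this]
  refine (abs_add_le _ _).trans ?_
  rw [abs_mul, abs_mul, abs_of_nonneg ha, abs_of_nonneg hb]

/-- The energy `½ a(y, y) + ‖y‖_{L¹} - (u, y)`. -/
def energy (u : L2 Ω) (y : GradPair Ω) : ℝ :=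
  1 / 2 * ‖y.snd‖ ^ 2 + normL1 y - ⟪u, y.fst⟫

theorem continuous_energy [IsFiniteMeasure (volume.restrict Ω)] (u : L2 Ω) :
    Continuous (energy u) := by
  unfold energy
  exact ((continuous_const.mul (continuous_gradPair_snd.norm.pow 2)).add continuous_normL1).sub
    (continuous_const.inner continuous_gradPair_fst)

theorem norm_snd_sub_sq (v y : GradPair Ω) :
    ‖v.snd‖ ^ 2 = ‖y.snd‖ ^ 2 + 2 * bilin y (v - y) + ‖(v - y).snd‖ ^ 2 := by
  have : v.snd = y.snd + (v - y).snd := by simp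
  conv_lhs => rw [this, norm_add_sq_real]
  rfl

/-- Expanding the quadratic part of the energy about `y`, the variational inequality says exactly
that everything except the second-order term is nonnegative. -/
theorem SolvesVI.energy_gap {V : Submodule ℝ (GradPair Ω)} {u : L2 Ω} {y : GradPair Ω}
    (hy : SolvesVI V u y) {v : GradPair Ω} (hv : v ∈ V) :
    1 / 2 * ‖(v - y).snd‖ ^ 2 ≤ energy u v - energy u y := by
  have h := hy.2 v hv
  have h1 := norm_snd_sub_sq v y
  have h2 : ⟪u, (v - y).fst⟫ = ⟪u, v.fst⟫ - ⟪u, y.fst⟫ := by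
    rw [← inner_sub_right]; rfl
  unfold energy
  linarith

/-- The minimizer is compared with points of the segment towards `v`. Convexity bounds the
nondifferentiable `L¹` term linearly in `t`; one divides by `t` and lets it tend to zero. -/
theorem solvesVI_of_isMinOn [IsFiniteMeasure (volume.restrict Ω)]
    {V : Submodule ℝ (GradPair Ω)} {u : L2 Ω} {y : GradPair Ω} (hyV : y ∈ V)
    (hy : IsMinOn (energy u) V y) : SolvesVI V u y := by
  refine ⟨hyV, fun v hv => ?_⟩
  set A := bilin y (v - y) + normL1 v - normL1 y - ⟪u, (v - y).fst⟫ with hA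
  set B := 1 / 2 * ‖(v - y).snd‖ ^ 2 with hB
  have hB0 : 0 ≤ B := by positivity
  have key : ∀ t : ℝ, 0 < t → t ≤ 1 → 0 ≤ A + t * B := by
    intro t ht ht1
    set z := (1 - t) • y + t • v with hz
    have hzV : z ∈ V := V.add_mem (V.smul_mem _ hyV) (V.smul_mem _ hv)
    have hmin : energy u y ≤ energy u z := hy hzV
    have hzy : z - y = t • (v - y) := by rw [hz]; module
    have h1 := norm_snd_sub_sq z y
    have h2 : bilin y (z - y) = t * bilin y (v - y) := by
      rw [hzy]; exact real_inner_smul_right _ _ _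
    have h3 : ‖(z - y).snd‖ ^ 2 = t ^ 2 * ‖(v - y).snd‖ ^ 2 := by
      rw [hzy, WithLp.smul_snd, norm_smul, mul_pow, Real.norm_eq_abs, sq_abs]
    have h4 : ⟪u, z.fst⟫ - ⟪u, y.fst⟫ = t * ⟪u, (v - y).fst⟫ := by
      rw [← inner_sub_right, ← real_inner_smul_right]
      congr 1
      exact congrArg WithLp.fst hzy
    have h5 := normL1_convex y v (sub_nonneg.2 ht1) ht.le
    rw [← hz] at h5
    unfold energy at hmin
    have : 0 ≤ t * (A + t * B) := by
      rw [hA, hB]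
      nlinarith
    exact nonneg_of_mul_nonneg_right this ht
  have hA0 : 0 ≤ A := by
    by_contra! hneg
    -- For this step size `t * B ≤ -A / 2`, so `A + t * B` would be negative; `B + 1` avoids
    -- division by zero.
    have hpos : 0 < -A / (2 * (B + 1)) := div_pos (by linarith) (by linarith)
    have := key (min 1 (-A / (2 * (B + 1)))) (lt_min one_pos hpos) (min_le_left _ _)
    have h2 : min 1 (-A / (2 * (B + 1))) * B ≤ -A / (2 * (B + 1)) * (B + 1) :=
      mul_le_mul (min_le_right _ _) (by linarith) hB0 hpos.le
    have h3 : -A / (2 * (B + 1)) * (B + 1) = -A / 2 := by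
      have : B + 1 ≠ 0 := by linarith
      field_simp
    linarith
  rw [hA] at hA0
  linarith

/-- Existence of solutions of the variational inequality on closed subspaces on which a Poincaré
inequality holds. -/
theorem exists_solvesVI [IsFiniteMeasure (volume.restrict Ω)] {V : Submodule ℝ (GradPair Ω)}
    (hV : IsClosed (V : Set (GradPair Ω))) {C : ℝ}
    (hP : ∀ v ∈ V, ‖v.fst‖ ≤ C * ‖v.snd‖) (u : L2 Ω) : ∃ y, SolvesVI V u y := by
  suffices ∃ y ∈ (V : Set (GradPair Ω)), IsMinOn (energy u) V y by
    obtain ⟨y, hyV, hy⟩ := this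
    exact ⟨y, solvesVI_of_isMinOn hyV hy⟩
  -- The parallelogram identity leaves `1/8` of the squared gradient difference, and Poincaré bounds
  -- the full norm squared by `C ^ 2 + 1` times it. The lower bound `m` comes from completing the
  -- square in `‖v.snd‖`.
  have hc : 0 < 1 / (8 * (C ^ 2 + 1)) := by positivity
  refine exists_isMinOn_of_uniform_midpoint (c := 1 / (8 * (C ^ 2 + 1)))
    (m := -(1 / 2 * (C * ‖u‖) ^ 2)) (continuous_energy u) hV ⟨0, V.zero_mem⟩ hc ?_ ?_
  · intro v hv
    have h1 := real_inner_le_norm u v.fst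
    have h2 := mul_le_mul_of_nonneg_left (hP v hv) (norm_nonneg u)
    have h3 := normL1_nonneg v
    unfold energy
    nlinarith [sq_nonneg (‖v.snd‖ - C * ‖u‖)]
  · intro v hv w hw
    refine ⟨(1 / 2 : ℝ) • v + (1 / 2 : ℝ) • w, V.add_mem (V.smul_mem _ hv) (V.smul_mem _ hw), ?_⟩
    have h1 := normL1_convex v w (by norm_num : (0 : ℝ) ≤ 1 / 2) (by norm_num : (0 : ℝ) ≤ 1 / 2)
    have h2 : ⟪u, ((1 / 2 : ℝ) • v + (1 / 2 : ℝ) • w).fst⟫ = (⟪u, v.fst⟫ + ⟪u, w.fst⟫) / 2 := by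
      rw [WithLp.add_fst, WithLp.smul_fst, WithLp.smul_fst, inner_add_right,
        real_inner_smul_right, real_inner_smul_right]
      ring
    have h3 : ‖((1 / 2 : ℝ) • v + (1 / 2 : ℝ) • w).snd‖ ^ 2
        = (‖v.snd‖ ^ 2 + ‖w.snd‖ ^ 2) / 2 - 1 / 4 * ‖(v - w).snd‖ ^ 2 := by
      rw [WithLp.add_snd, WithLp.smul_snd, WithLp.smul_snd, ← smul_add, norm_smul, mul_pow,
        WithLp.sub_snd, norm_add_sq_real, norm_sub_sq_real]
      norm_num
      ring
    have h4 : ‖v - w‖ ^ 2 ≤ (C ^ 2 + 1) * ‖(v - w).snd‖ ^ 2 := by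
      have := pow_le_pow_left₀ (norm_nonneg _) (hP _ (V.sub_mem hv hw)) 2
      rw [norm_sq_gradPair]
      nlinarith
    have h5 : 1 / (8 * (C ^ 2 + 1)) * ‖v - w‖ ^ 2 ≤ 1 / 8 * ‖(v - w).snd‖ ^ 2 := by
      rw [div_mul_eq_mul_div, div_le_iff₀ (by positivity)]
      nlinarith
    unfold energy
    rw [h2, h3]
    linarith

/-- Stability of the variational inequality with respect to the right-hand side. -/
theorem SolvesVI.stability {V : Submodule ℝ (GradPair Ω)} {u w : L2 Ω} {y z : GradPair Ω}
    (hy : SolvesVI V u y) (hz : SolvesVI V w z) :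
    ‖(y - z).snd‖ ^ 2 ≤ ⟪u - w, (y - z).fst⟫ := by
  have h1 := hy.2 z hz.1
  have h2 := hz.2 y hy.1
  have h3 : bilin y (z - y) + bilin z (y - z) = -‖(y - z).snd‖ ^ 2 := by
    unfold bilin
    rw [← real_inner_self_eq_norm_sq, WithLp.sub_snd, WithLp.sub_snd, inner_sub_right,
      inner_sub_right, inner_sub_sub_self, real_inner_comm y.snd z.snd]
    ring
  have h4 : ⟪u, (z - y).fst⟫ = -⟪u, (y - z).fst⟫ := by
    rw [← inner_neg_right, ← neg_sub y z]; rfl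
  rw [inner_sub_left]
  linarith

theorem solvesVI_solOp [IsFiniteMeasure (volume.restrict Ω)] {V : Submodule ℝ (GradPair Ω)}
    (hV : IsClosed (V : Set (GradPair Ω))) {C : ℝ}
    (hP : ∀ v ∈ V, ‖v.fst‖ ≤ C * ‖v.snd‖) (u : L2 Ω) : SolvesVI V u (solOp V u) := by
  have h := exists_solvesVI hV hP u
  unfold solOp
  rw [dif_pos h]
  exact h.choose_spec

/-- If `|(u - w, v)| ≤ κ ‖∇v‖` on `V`, then the gradients of the states differ by at most `κ`. -/
theorem norm_snd_sub_le_of_inner_le {V : Submodule ℝ (GradPair Ω)} {u w : L2 Ω}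
    {y z : GradPair Ω} (hy : SolvesVI V u y) (hz : SolvesVI V w z) {κ : ℝ}
    (hκ : 0 ≤ κ) (h : ∀ v ∈ V, ⟪u - w, v.fst⟫ ≤ κ * ‖v.snd‖) : ‖(y - z).snd‖ ≤ κ := by
  have h1 := hy.stability hz
  have h2 := h _ (V.sub_mem hy.1 hz.1)
  by_contra! hlt
  nlinarith [norm_nonneg (y - z).snd]

/-- Quasi-optimality of the discrete state in terms of energies. -/
theorem norm_snd_sub_sq_le_energy {V W : Submodule ℝ (GradPair Ω)} (hWV : W ≤ V) {u : L2 Ω}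
    {y z v : GradPair Ω} (hy : SolvesVI V u y) (hz : SolvesVI W u z) (hv : v ∈ W) :
    ‖(z - y).snd‖ ^ 2 ≤ 2 * (energy u v - energy u y) := by
  have h1 := hy.energy_gap (hWV hz.1)
  have h2 := hz.energy_gap hv
  nlinarith [sq_nonneg ‖(v - z).snd‖]

end Variational

/-! ### Poincaré's inequality -/

section Poincare

variable {d : ℕ} {Ω : Set (Eucl d)}

theorem norm_gradient_eq (φ : Eucl d → ℝ) (x : Eucl d) : ‖gradient φ x‖ = ‖fderiv ℝ φ x‖ := by
  simp [gradient]

theorem inner_gradient_eq (φ : Eucl d → ℝ) (x e : Eucl d) :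
    ⟪gradient φ x, e⟫ = fderiv ℝ φ x e := by
  simp [gradient]

theorem gradient_eq_zero_of_notMem_tsupport {φ : Eucl d → ℝ} {x : Eucl d}
    (hx : x ∉ tsupport φ) : gradient φ x = 0 := by
  have : fderiv ℝ φ x = 0 := by
    by_contra h
    exact hx (support_fderiv_subset ℝ h)
  simp [gradient, this]

theorem measurable_gradient (φ : Eucl d → ℝ) : Measurable (gradient φ) :=
  (InnerProductSpace.toDual ℝ (Eucl d)).symm.continuous.measurable.comp (measurable_fderiv ℝ φ)

theorem norm_sq_Lp_two {F : Type*} [NormedAddCommGroup F] [InnerProductSpace ℝ F]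
    {α : Type*} [MeasurableSpace α] {μ : Measure α} (f : Lp F 2 μ) :
    ‖f‖ ^ 2 = ∫ x, ‖f x‖ ^ 2 ∂μ := by
  rw [← real_inner_self_eq_norm_sq, L2.inner_def]
  simp

/-- For `L²` functions with representatives vanishing off `Ω`, the norm is an integral over the
whole space. -/
theorem norm_sq_eq_integral_of_ae_eq {F : Type*} [NormedAddCommGroup F] [InnerProductSpace ℝ F]
    {f : Lp F 2 (volume.restrict Ω)} {φ : Eucl d → F} (h : f =ᵐ[volume.restrict Ω] φ)
    (h0 : ∀ x ∉ Ω, φ x = 0) : ‖f‖ ^ 2 = ∫ x, ‖φ x‖ ^ 2 := by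
  have h1 : ∫ x in Ω, ‖φ x‖ ^ 2 = ∫ x, ‖φ x‖ ^ 2 :=
    setIntegral_eq_integral_of_forall_compl_eq_zero fun x hx => by simp [h0 x hx]
  rw [norm_sq_Lp_two, ← h1]
  exact integral_congr_ae (h.mono fun x hx => by simp only [hx])

theorem continuous_gradient {φ : Eucl d → ℝ} (hφ : ContDiff ℝ ∞ φ) : Continuous (gradient φ) :=
  (InnerProductSpace.toDual ℝ (Eucl d)).symm.continuous.comp (hφ.continuous_fderiv (by simp))

theorem hasCompactSupport_gradient {φ : Eucl d → ℝ} (hφ : HasCompactSupport φ) :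
    HasCompactSupport (gradient φ) :=
  HasCompactSupport.intro hφ fun _ hx => gradient_eq_zero_of_notMem_tsupport hx

theorem integrable_norm_sq {F : Type*} [NormedAddCommGroup F] {φ : Eucl d → F}
    (hφ : Continuous φ) (hc : HasCompactSupport φ) : Integrable fun x => ‖φ x‖ ^ 2 :=
  (hφ.norm.pow 2).integrable_of_hasCompactSupport
    (HasCompactSupport.intro hc fun x hx => by simp [image_eq_zero_of_notMem_tsupport hx])

/-- Integration by parts against the first coordinate gives $\int\varphi^2=-\int
2x_1\varphi\,\partial_1\varphi$. Young's inequality with $|x_1|\le R$ on the support bounds this by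
$\frac12\int\varphi^2+2R^2\int|\nabla\varphi|^2$, and the first term is absorbed. -/
theorem poincare_smooth (hd : 1 ≤ d) {φ : Eucl d → ℝ} {R : ℝ} (h1 : ContDiff ℝ ∞ φ)
    (h2 : HasCompactSupport φ) (hR : ∀ x ∈ tsupport φ, ‖x‖ ≤ R) :
    ∫ x, ‖φ x‖ ^ 2 ≤ (2 * R) ^ 2 * ∫ x, ‖gradient φ x‖ ^ 2 := by
  set e : Eucl d := EuclideanSpace.single ⟨0, hd⟩ 1 with he
  have hen : ‖e‖ = 1 := by simp [he]
  have hφd : Differentiable ℝ φ := h1.differentiable (by simp)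
  set f : Eucl d → ℝ := fun x => ⟪e, x⟫ with hf
  have hfd : ∀ x, HasFDerivAt f (innerSL ℝ e) x := fun x => (innerSL ℝ e).hasFDerivAt
  have hfe : ∀ x, fderiv ℝ f x e = 1 := by
    intro x
    rw [(hfd x).fderiv]
    simp [hen]
  have hgd : ∀ x, HasFDerivAt (fun x => φ x ^ 2) ((2 * φ x) • fderiv ℝ φ x) x := by
    intro x
    simpa using (hφd x).hasFDerivAt.pow 2
  have hge : ∀ x, fderiv ℝ (fun x => φ x ^ 2) x e = 2 * φ x * ⟪gradient φ x, e⟫ := by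
    intro x
    rw [(hgd x).fderiv, inner_gradient_eq]
    rfl
  have hfc : Continuous f := continuous_const.inner continuous_id
  have hIφ : Integrable fun x => φ x ^ 2 := by
    simpa using integrable_norm_sq h1.continuous h2
  have hIg := integrable_norm_sq (continuous_gradient h1) (hasCompactSupport_gradient h2)
  have hsq : HasCompactSupport fun x => φ x ^ 2 :=
    h2.comp_left (g := fun y => y ^ 2) (by simp)
  have hIfg : Integrable fun x => f x * (2 * φ x * ⟪gradient φ x, e⟫) := by
    refine Continuous.integrable_of_hasCompactSupport ?_ ?_
    · exact hfc.mul ((continuous_const.mul h1.continuous).mul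
        ((continuous_gradient h1).inner continuous_const))
    · refine HasCompactSupport.intro h2 fun x hx => ?_
      simp [image_eq_zero_of_notMem_tsupport hx]
  have hparts := integral_mul_fderiv_eq_neg_fderiv_mul_of_integrable (μ := volume)
    (f := f) (g := fun x => φ x ^ 2) (v := e)
    (by simpa [hfe] using hIφ) (by simpa only [hge] using hIfg)
    ((hfc.mul (h1.continuous.pow 2)).integrable_of_hasCompactSupport hsq.mul_left)
    (fun x _ => (hfd x).differentiableAt) (fun x _ => (hgd x).differentiableAt)
  simp only [hfe, hge, one_mul] at hparts
  have hpt : ∀ x, -(f x * (2 * φ x * ⟪gradient φ x, e⟫))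
      ≤ 1 / 2 * φ x ^ 2 + 2 * R ^ 2 * ‖gradient φ x‖ ^ 2 := by
    intro x
    by_cases hx : x ∈ tsupport φ
    · have hxR := hR x hx
      have hR0 : 0 ≤ R := (norm_nonneg x).trans hxR
      have a1 : |f x| ≤ R := (abs_real_inner_le_norm e x).trans (by rw [hen, one_mul]; exact hxR)
      have a2 : |⟪gradient φ x, e⟫| ≤ ‖gradient φ x‖ :=
        (abs_real_inner_le_norm _ _).trans (by rw [hen, mul_one])
      have a3 : |f x * ⟪gradient φ x, e⟫| ≤ R * ‖gradient φ x‖ := by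
        rw [abs_mul]
        exact mul_le_mul a1 a2 (abs_nonneg _) hR0
      have a4 := pow_le_pow_left₀ (abs_nonneg _) a3 2
      rw [sq_abs] at a4
      nlinarith [sq_nonneg (φ x + 2 * (f x * ⟪gradient φ x, e⟫))]
    · rw [image_eq_zero_of_notMem_tsupport hx]
      simp only [mul_zero, zero_mul, neg_zero]
      positivity
  have hle := integral_mono hIfg.neg ((hIφ.const_mul (1 / 2)).add (hIg.const_mul (2 * R ^ 2))) hpt
  simp only [Pi.add_apply, Pi.neg_apply] at hle
  rw [integral_neg, hparts, integral_add (hIφ.const_mul _) (hIg.const_mul _), integral_const_mul,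
    integral_const_mul] at hle
  simp only [Real.norm_eq_abs, sq_abs] at *
  nlinarith

theorem mem_H10_of_closed {P : GradPair Ω → Prop} (hP : IsClosed {v | P v})
    (h : ∀ v ∈ testPairs Ω, P v) {v : GradPair Ω} (hv : v ∈ H10 Ω) : P v :=
  closure_minimal (s := (testPairs Ω : Set (GradPair Ω))) h hP hv

/-- Poincaré's inequality on `H₀¹(Ω)` for bounded `Ω`. -/
theorem exists_poincare (hd : 1 ≤ d) (hΩ : Bornology.IsBounded Ω) :
    ∃ C > 0, ∀ v ∈ H10 Ω, ‖v.fst‖ ≤ C * ‖v.snd‖ := by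
  obtain ⟨R, hR0, hR⟩ := hΩ.exists_pos_norm_le
  refine ⟨2 * R, by positivity, fun v hv => ?_⟩
  refine mem_H10_of_closed (P := fun v => ‖v.fst‖ ≤ 2 * R * ‖v.snd‖) ?_ ?_ hv
  · exact isClosed_le continuous_gradPair_fst.norm
      (continuous_const.mul continuous_gradPair_snd.norm)
  · rintro v ⟨φ, h1, h2, h3, h4, h5⟩
    have hP := poincare_smooth hd h1 h2 fun x hx => hR x (h3 hx)
    rw [← norm_sq_eq_integral_of_ae_eq h4 fun x hx =>
        image_eq_zero_of_notMem_tsupport fun h => hx (h3 h),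
      ← norm_sq_eq_integral_of_ae_eq h5 fun x hx =>
        gradient_eq_zero_of_notMem_tsupport fun h => hx (h3 h), ← mul_pow] at hP
    exact le_of_sq_le_sq hP (by positivity)

end Poincare

/-! ### Finite dimension from finitely many restrictions -/

section Comap

variable {E ι : Type*} [AddCommGroup E] [Module ℝ E] {F : ι → Type*} [∀ i, AddCommGroup (F i)]
  [∀ i, Module ℝ (F i)]

/-- The maps `r i` jointly embed the intersection into the finite product of the `D i`. In the
application they are the restrictions to the simplices of a mesh. -/
theorem finiteDimensional_iInf_comap [Finite ι] (r : ∀ i, E →ₗ[ℝ] F i)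
    (D : ∀ i, Submodule ℝ (F i)) [∀ i, FiniteDimensional ℝ (D i)]
    (hr : ∀ x, (∀ i, r i x = 0) → x = 0) :
    FiniteDimensional ℝ (⨅ i, (D i).comap (r i) : Submodule ℝ E) := by
  let q : ∀ i, (⨅ i, (D i).comap (r i) : Submodule ℝ E) →ₗ[ℝ] D i := fun i =>
    ((r i).comp (Submodule.subtype _)).codRestrict _ fun f => (Submodule.mem_iInf _).1 f.2 i
  refine Module.Finite.of_injective (LinearMap.pi q) ?_
  rw [← LinearMap.ker_eq_bot, Submodule.eq_bot_iff]
  intro f hf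
  exact Subtype.ext (hr _ fun i => congrArg Subtype.val (congrFun (LinearMap.mem_ker.1 hf) i))

end Comap

/-! ### Piecewise affine functions: closedness and finite dimension -/

section FiniteElementSpace

variable {d : ℕ} {Ω : Set (Eucl d)}

theorem isFiniteMeasure_restrict (hΩ : Bornology.IsBounded Ω) :
    IsFiniteMeasure (volume.restrict Ω) :=
  ⟨by simpa using hΩ.measure_lt_top⟩

theorem memLp_affine (hΩo : IsOpen Ω) (hΩ : Bornology.IsBounded Ω) (s : Set (Eucl d))
    (q : ℝ × Eucl d) :
    MemLp (fun x => q.1 + ⟪q.2, x⟫) 2 ((volume.restrict Ω).restrict s) := by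
  obtain ⟨R, hR0, hR⟩ := hΩ.exists_pos_norm_le
  have := isFiniteMeasure_restrict hΩ
  have hc : Continuous fun x : Eucl d => q.1 + ⟪q.2, x⟫ :=
    continuous_const.add (continuous_const.inner continuous_id)
  refine MemLp.mono_measure Measure.restrict_le_self
    (MemLp.of_bound hc.aestronglyMeasurable (|q.1| + ‖q.2‖ * R) ?_)
  refine ae_restrict_of_forall_mem hΩo.measurableSet fun x hx => ?_
  refine (norm_add_le _ _).trans (add_le_add le_rfl ((norm_inner_le_norm _ _).trans ?_))
  exact mul_le_mul_of_nonneg_left (hR x hx) (norm_nonneg _)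

/-- The affine functions as elements of `L²(Ω ∩ s)`. -/
def affineToL2 (hΩo : IsOpen Ω) (hΩ : Bornology.IsBounded Ω) (s : Set (Eucl d)) :
    (ℝ × Eucl d) →ₗ[ℝ] Lp ℝ 2 ((volume.restrict Ω).restrict s) where
  toFun q := (memLp_affine hΩo hΩ s q).toLp _
  map_add' q r := by
    rw [← MemLp.toLp_add]
    refine MemLp.toLp_congr _ _ (Eventually.of_forall fun x => ?_)
    simp only [Prod.fst_add, Prod.snd_add, inner_add_left, Pi.add_apply]
    ring
  map_smul' c q := by
    rw [RingHom.id_apply, ← MemLp.toLp_const_smul]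
    refine MemLp.toLp_congr _ _ (Eventually.of_forall fun x => ?_)
    simp only [Prod.smul_fst, Prod.smul_snd, real_inner_smul_left, Pi.smul_apply, smul_eq_mul]
    ring

/-- The functions of `L²(Ω)` that are affine on each of the given sets. -/
def piecewiseAffine (hΩo : IsOpen Ω) (hΩ : Bornology.IsBounded Ω)
    (A : Finset (Finset (Eucl d))) : Submodule ℝ (L2 Ω) :=
  ⨅ s : A, (LinearMap.range (affineToL2 hΩo hΩ (convexHull ℝ (s : Set (Eucl d))))).comap
    (LpToLpRestrictCLM (Eucl d) ℝ ℝ (volume.restrict Ω) 2 (convexHull ℝ (s : Set (Eucl d)))).toLinearMap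

theorem measurableSet_convexHull_finset (s : Finset (Eucl d)) :
    MeasurableSet (convexHull ℝ (s : Set (Eucl d))) :=
  (s.finite_toSet.isCompact_convexHull (𝕜 := ℝ)).measurableSet

theorem mem_piecewiseAffine_iff (hΩo : IsOpen Ω) (hΩ : Bornology.IsBounded Ω)
    (A : Finset (Finset (Eucl d))) (f : L2 Ω) :
    f ∈ piecewiseAffine hΩo hΩ A ↔ ∀ s ∈ A, ∃ g : Eucl d →ᵃ[ℝ] ℝ,
      ∀ᵐ x ∂(volume.restrict Ω), x ∈ convexHull ℝ (s : Set (Eucl d)) → f x = g x := by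
  rw [piecewiseAffine, Submodule.mem_iInf, Subtype.forall]
  refine forall₂_congr fun s _ => ?_
  have hm := measurableSet_convexHull_finset s
  set S := convexHull ℝ (s : Set (Eucl d)) with hS
  have key : ∀ q : ℝ × Eucl d, affineToL2 hΩo hΩ S q =
      LpToLpRestrictCLM (Eucl d) ℝ ℝ (volume.restrict Ω) 2 S f ↔
      ∀ᵐ x ∂(volume.restrict Ω), x ∈ S → f x = q.1 + ⟪q.2, x⟫ := by
    intro q
    rw [← ae_restrict_iff' hm, Lp.ext_iff]
    have h1 := LpToLpRestrictCLM_coeFn (μ := volume.restrict Ω) (p := 2) ℝ S f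
    have h2 : affineToL2 hΩo hΩ S q =ᵐ[(volume.restrict Ω).restrict S] fun x => q.1 + ⟪q.2, x⟫ :=
      (memLp_affine hΩo hΩ S q).coeFn_toLp
    constructor
    · intro h
      filter_upwards [h1, h2, h] with x a b c
      rw [← a, ← c, b]
    · intro h
      filter_upwards [h1, h2, h] with x a b c
      rw [a, b, c]
  change (∃ q, affineToL2 hΩo hΩ S q = _) ↔ _
  constructor
  · rintro ⟨q, hq⟩
    refine ⟨AffineMap.const ℝ _ q.1 + (innerSL ℝ q.2).toLinearMap.toAffineMap, ?_⟩
    simpa using (key q).1 hq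
  · rintro ⟨g, hg⟩
    refine ⟨(g 0, (InnerProductSpace.toDual ℝ (Eucl d)).symm
      (LinearMap.toContinuousLinearMap g.linear)), (key _).2 (hg.mono fun x hx hxS => ?_)⟩
    rw [hx hxS, InnerProductSpace.toDual_symm_apply, AffineMap.decomp g]
    simp [add_comm]

theorem isClosed_piecewiseAffine (hΩo : IsOpen Ω) (hΩ : Bornology.IsBounded Ω)
    (A : Finset (Finset (Eucl d))) : IsClosed (piecewiseAffine hΩo hΩ A : Set (L2 Ω)) := by
  rw [piecewiseAffine, Submodule.coe_iInf]
  refine isClosed_iInter fun s => ?_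
  have h := Submodule.closed_of_finiteDimensional
    (LinearMap.range (affineToL2 hΩo hΩ (convexHull ℝ (s : Set (Eucl d)))))
  exact h.preimage (LpToLpRestrictCLM (Eucl d) ℝ ℝ (volume.restrict Ω) 2
    (convexHull ℝ (s : Set (Eucl d)))).continuous

theorem finiteDimensional_piecewiseAffine (hΩo : IsOpen Ω) (hΩ : Bornology.IsBounded Ω)
    (A : Finset (Finset (Eucl d)))
    (hA : Ω ⊆ ⋃ s ∈ A, convexHull ℝ (s : Set (Eucl d))) :
    FiniteDimensional ℝ (piecewiseAffine hΩo hΩ A) := by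
  refine finiteDimensional_iInf_comap _ _ fun f hf => ?_
  have hs : ∀ s ∈ A, ∀ᵐ x ∂(volume.restrict Ω), x ∈ convexHull ℝ (s : Set (Eucl d)) →
      f x = 0 := by
    intro s hs
    rw [← ae_restrict_iff' (measurableSet_convexHull_finset s)]
    have h1 := LpToLpRestrictCLM_coeFn (μ := volume.restrict Ω) (p := 2) ℝ
      (convexHull ℝ (s : Set (Eucl d))) f
    have h2 : LpToLpRestrictCLM (Eucl d) ℝ ℝ (volume.restrict Ω) 2
        (convexHull ℝ (s : Set (Eucl d))) f = 0 :=
      hf ⟨s, hs⟩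
    rw [h2] at h1
    filter_upwards [h1, Lp.coeFn_zero ℝ 2 _] with x a b
    rw [← a, b]
    rfl
  have hall := (Finset.eventually_all A).2 hs
  refine Lp.ext ?_
  filter_upwards [hall, ae_restrict_mem hΩo.measurableSet,
    Lp.coeFn_zero ℝ 2 (volume.restrict Ω)] with x hx hxΩ h0
  obtain ⟨s, hsA, hxs⟩ := mem_iUnion₂.1 (hA hxΩ)
  rw [hx s hsA hxs]
  exact h0.symm

theorem Mesh.subset_cover (T : Mesh Ω) : Ω ⊆ ⋃ s ∈ T.elements, convexHull ℝ (s : Set (Eucl d)) :=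
  T.covers ▸ subset_closure

theorem Mesh.mem_space_iff (hΩo : IsOpen Ω) (hΩ : Bornology.IsBounded Ω) (T : Mesh Ω)
    (v : GradPair Ω) :
    v ∈ T.space ↔ v ∈ H10 Ω ∧ v.fst ∈ piecewiseAffine hΩo hΩ T.elements := by
  rw [mem_piecewiseAffine_iff]
  rfl

theorem isClosed_H10 : IsClosed (H10 Ω : Set (GradPair Ω)) :=
  Submodule.isClosed_topologicalClosure _

theorem Mesh.isClosed_space (hΩo : IsOpen Ω) (hΩ : Bornology.IsBounded Ω) (T : Mesh Ω) :
    IsClosed (T.space : Set (GradPair Ω)) := by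
  have : (T.space : Set (GradPair Ω)) = (H10 Ω : Set (GradPair Ω)) ∩
      {v | v.fst ∈ (piecewiseAffine hΩo hΩ T.elements : Set (L2 Ω))} := by
    ext v
    exact T.mem_space_iff hΩo hΩ v
  rw [this]
  exact isClosed_H10.inter ((isClosed_piecewiseAffine hΩo hΩ T.elements).preimage
    continuous_gradPair_fst)

end FiniteElementSpace

/-! ### Gluing Lipschitz bounds -/

section Lipschitz

/-- A function that is Lipschitz on each set of a finite closed cover is Lipschitz. -/
theorem abs_sub_le_of_finite_closed_cover {E ι : Type*} [NormedAddCommGroup E] [NormedSpace ℝ E]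
    [Finite ι] {A : ι → Set E} (hA : ∀ i, IsClosed (A i)) (hcov : ⋃ i, A i = univ) {w : E → ℝ}
    {L : ℝ} (hL : 0 ≤ L) (hw : ∀ i, ∀ x ∈ A i, ∀ y ∈ A i, |w x - w y| ≤ L * ‖x - y‖) (x y : E) :
    |w x - w y| ≤ L * ‖x - y‖ := by
  have hcont : Continuous w := by
    refine (locallyFinite_of_finite A).continuous hcov hA fun i => ?_
    have : LipschitzOnWith (Real.toNNReal L) w (A i) :=
      LipschitzOnWith.of_dist_le_mul fun x hx y hy => by
        rw [Real.dist_eq, dist_eq_norm, Real.coe_toNNReal L hL]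
        exact hw i x hx y hy
    exact this.continuousOn
  have key : ∀ x y : E, w y - w x ≤ L * ‖y - x‖ := by
    intro x y
    set γ : ℝ → E := fun t => x + t • (y - x) with hγ
    have hγc : Continuous γ := by fun_prop
    have hmain := image_le_of_liminf_slope_right_le_deriv_boundary (f := fun t => w (γ t))
      (a := 0) (b := 1) (B := fun t => w x + t * (L * ‖y - x‖)) (B' := fun _ => L * ‖y - x‖)
      (hcont.comp hγc).continuousOn (by simp [hγ]) (by fun_prop)
      (fun t _ => by
        simpa using (((hasDerivAt_id t).mul_const (L * ‖y - x‖)).const_add (w x)).hasDerivWithinAt)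
      (fun t _ r hr => ?_) (right_mem_Icc.2 zero_le_one)
    · simp only [hγ, one_smul, add_sub_cancel, one_mul] at hmain
      linarith
    -- By finiteness of the cover one set is met arbitrarily close to the right of `t`; being
    -- closed, it also contains `γ t`, so its Lipschitz bound applies to both points.
    · have hfreq : ∃ i, ∃ᶠ z in 𝓝[>] t, γ z ∈ A i := by
        by_contra! hnot
        obtain ⟨z, hz⟩ := (eventually_all.2 hnot).exists
        obtain ⟨i, hi⟩ := mem_iUnion.1 (hcov.symm ▸ mem_univ (γ z) : γ z ∈ ⋃ i, A i)
        exact hz i hi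
      obtain ⟨i, hi⟩ := hfreq
      have hti : γ t ∈ A i := (hA i).mem_of_frequently_of_tendsto hi
        ((hγc.tendsto t).mono_left nhdsWithin_le_nhds)
      refine (hi.and_eventually self_mem_nhdsWithin).mono fun z ⟨hz, hzt⟩ => ?_
      have hzt' : 0 < z - t := sub_pos.2 hzt
      rw [slope_def_field]
      refine lt_of_le_of_lt ?_ hr
      rw [div_le_iff₀ hzt']
      refine (le_abs_self _).trans ((hw i _ hz _ hti).trans (le_of_eq ?_))
      have : γ z - γ t = (z - t) • (y - x) := by simp only [hγ]; module
      rw [this, norm_smul, Real.norm_of_nonneg hzt'.le]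
      ring
  rw [abs_le]
  constructor
  · have := key x y
    rw [norm_sub_rev] at this
    linarith
  · exact key y x

end Lipschitz

/-! ### Lipschitz functions in the closure of the test functions -/

section Mollification

variable {d : ℕ} {Ω : Set (Eucl d)}

theorem tendsto_toLp_of_dominated {F α : Type*} [NormedAddCommGroup F] [InnerProductSpace ℝ F]
    [MeasurableSpace α] {μ : Measure α} [IsFiniteMeasure μ] {f : ℕ → α → F} {g : α → F}
    (hf : ∀ n, MemLp (f n) 2 μ) (hg : MemLp g 2 μ) {M : ℝ} (hM : ∀ n, ∀ᵐ x ∂μ, ‖f n x - g x‖ ≤ M)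
    (hlim : ∀ᵐ x ∂μ, Tendsto (fun n => f n x) atTop (𝓝 (g x))) :
    Tendsto (fun n => (hf n).toLp (f n)) atTop (𝓝 (hg.toLp g)) := by
  rw [tendsto_iff_norm_sub_tendsto_zero]
  have h1 : Tendsto (fun n => ‖(hf n).toLp (f n) - hg.toLp g‖ ^ 2) atTop (𝓝 0) := by
    have h2 : ∀ n, ‖(hf n).toLp (f n) - hg.toLp g‖ ^ 2 = ∫ x, ‖f n x - g x‖ ^ 2 ∂μ := by
      intro n
      rw [← MemLp.toLp_sub, norm_sq_Lp_two]
      refine integral_congr_ae (((hf n).sub hg).coeFn_toLp.mono fun x hx => ?_)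
      simp only [hx, Pi.sub_apply]
    simp only [h2]
    have h3 := tendsto_integral_of_dominated_convergence (μ := μ) (f := fun _ => (0 : ℝ))
      (F := fun n x => ‖f n x - g x‖ ^ 2) (fun _ => M ^ 2)
      (fun n => (((hf n).1.sub hg.1).norm.pow 2)) (integrable_const _)
      (fun n => (hM n).mono fun x hx => by
        rw [Real.norm_of_nonneg (by positivity)]
        exact pow_le_pow_left₀ (norm_nonneg _) hx 2)
      (hlim.mono fun x hx => by
        have := ((hx.sub_const (g x)).norm.pow 2)
        simpa using this)
    simpa using h3
  simpa [Function.comp_def] using (Real.continuous_sqrt.tendsto _).comp h1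

theorem hasFDerivAt_of_eventuallyEq_affine {E : Type*} [NormedAddCommGroup E] [NormedSpace ℝ E]
    {w : E → ℝ} {x : E} {c : ℝ} {G : E →L[ℝ] ℝ} (h : ∀ᶠ y in 𝓝 x, w y = c + G (y - x)) :
    HasFDerivAt w G x := by
  have hlin : HasFDerivAt (fun y => c + G (y - x)) G x := by
    simpa using (G.hasFDerivAt.comp x ((hasFDerivAt_id x).sub_const x)).const_add c
  exact hlin.congr_of_eventuallyEq h

open scoped Convolution in
/-- Mollifying a Lipschitz function. -/
theorem exists_mollification {w : Eucl d → ℝ} {K : NNReal} (hw : LipschitzWith K w)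
    {r : ℝ} (hr : 0 < r) :
    ∃ f : Eucl d → ℝ, ContDiff ℝ ∞ f ∧ tsupport f ⊆ Metric.cthickening r (tsupport w) ∧
      LipschitzWith K f ∧ (∀ x, |f x - w x| ≤ K * r) ∧
      ∀ x (G : Eucl d →L[ℝ] ℝ), (∀ y ∈ Metric.ball x (2 * r), w y = w x + G (y - x)) →
        HasFDerivAt f G x := by
  let φ : ContDiffBump (0 : Eucl d) := ⟨r / 2, r, by positivity, by linarith⟩
  set f : Eucl d → ℝ := (φ.normed volume) ⋆[ContinuousLinearMap.lsmul ℝ ℝ, volume] w with hf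
  have hint : ∀ x, Integrable fun t => φ.normed volume t * w (x - t) := fun x =>
    (φ.continuous_normed.mul (hw.continuous.comp (by fun_prop))).integrable_of_hasCompactSupport
      φ.hasCompactSupport_normed.mul_right
  have hfx : ∀ x, f x = ∫ t, φ.normed volume t * w (x - t) := fun x => rfl
  have hdiff : ∀ x y, f x - f y = ∫ t, φ.normed volume t * (w (x - t) - w (y - t)) := by
    intro x y
    rw [hfx, hfx, ← integral_sub (hint x) (hint y)]
    simp only [mul_sub]
  have hsupp : ∀ t, φ.normed volume t ≠ 0 → ‖t‖ < r := by
    intro t ht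
    have : t ∈ Function.support (φ.normed volume) := ht
    rw [φ.support_normed_eq] at this
    simpa using this
  refine ⟨f, ?_, ?_, ?_, ?_, ?_⟩
  · exact φ.hasCompactSupport_normed.contDiff_convolution_left (n := ⊤) _ φ.contDiff_normed
      hw.continuous.locallyIntegrable
  · refine closure_minimal ?_ Metric.isClosed_cthickening
    intro x hx
    obtain ⟨a, ha, b, hb, rfl⟩ := support_convolution_subset _ hx
    refine Metric.mem_cthickening_of_dist_le _ b _ _ (subset_tsupport _ hb) ?_
    rw [dist_eq_norm]
    simpa using (hsupp a ha).le
  · refine LipschitzWith.of_dist_le_mul fun x y => ?_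
    rw [Real.dist_eq, hdiff, ← Real.norm_eq_abs]
    refine (norm_integral_le_of_norm_le (g := fun t => φ.normed volume t * (K * dist x y))
      (φ.integrable_normed.mul_const _) (Eventually.of_forall fun t => ?_)).trans ?_
    · rw [norm_mul, Real.norm_of_nonneg (φ.nonneg_normed t)]
      refine mul_le_mul_of_nonneg_left ?_ (φ.nonneg_normed t)
      rw [← dist_eq_norm]
      simpa using hw.dist_le_mul (x - t) (y - t)
    · rw [integral_mul_const, φ.integral_normed, one_mul]
  · intro x
    rw [← Real.dist_eq]
    refine φ.dist_normed_convolution_le hw.continuous.aestronglyMeasurable fun y hy => ?_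
    exact (hw.dist_le_mul _ _).trans (mul_le_mul_of_nonneg_left (Metric.mem_ball.1 hy).le K.2)
  · intro x G hG
    -- Convolution at a point within `r` of `x` sees only values within `2 * r` of `x`, where `w` is
    -- affine.
    have hloc : ∀ y ∈ Metric.ball x r, f y = f x + G (y - x) := by
      intro y hy
      rw [← sub_eq_iff_eq_add', hdiff]
      have : ∀ t, φ.normed volume t * (w (y - t) - w (x - t)) =
          φ.normed volume t * G (y - x) := by
        intro t
        by_cases ht : φ.normed volume t = 0
        · simp [ht]
        have ht' := hsupp t ht
        rw [hG (y - t), hG (x - t)]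
        · rw [add_sub_add_left_eq_sub, ← map_sub]
          congr 2
          abel
        · rw [Metric.mem_ball, dist_eq_norm]
          simp only [sub_sub_cancel_left, norm_neg]
          linarith
        · rw [Metric.mem_ball, dist_eq_norm]
          have h1 : ‖y - t - x‖ ≤ ‖y - x‖ + ‖t‖ := by
            rw [sub_right_comm]; exact norm_sub_le _ _
          have h2 := mem_ball_iff_norm.1 hy
          linarith
      simp only [this]
      rw [integral_mul_const, φ.integral_normed, one_mul]
    exact hasFDerivAt_of_eventuallyEq_affine (eventually_of_mem (Metric.ball_mem_nhds x hr) hloc)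

theorem norm_gradient_le_of_lipschitz {w : Eucl d → ℝ} {K : NNReal} (hw : LipschitzWith K w)
    (x : Eucl d) : ‖gradient w x‖ ≤ K := by
  rw [norm_gradient_eq]
  exact norm_fderiv_le_of_lipschitz ℝ hw

/-- A Lipschitz function with compact support in `Ω` that is locally affine almost everywhere
belongs to `H₀¹(Ω)`. -/
theorem exists_mem_H10_of_lipschitz (hΩo : IsOpen Ω) (hΩ : Bornology.IsBounded Ω)
    {w : Eucl d → ℝ} {K : NNReal} (hw : LipschitzWith K w) (hsupp : tsupport w ⊆ Ω)
    (haff : ∀ᵐ x ∂(volume.restrict Ω),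
      ∃ G : Eucl d →L[ℝ] ℝ, ∀ᶠ y in 𝓝 x, w y = w x + G (y - x)) :
    ∃ p ∈ H10 Ω, p.fst =ᵐ[volume.restrict Ω] w ∧ p.snd =ᵐ[volume.restrict Ω] gradient w := by
  have := isFiniteMeasure_restrict hΩ
  have hcs : HasCompactSupport w :=
    Metric.isCompact_of_isClosed_isBounded (isClosed_tsupport w) (hΩ.subset hsupp)
  obtain ⟨r, hr, hrΩ⟩ := hcs.exists_cthickening_subset_open hΩo hsupp
  set ρ : ℕ → ℝ := fun n => r * (1 / ((n : ℝ) + 1)) with hρ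
  have hρpos : ∀ n, 0 < ρ n := fun n => by positivity
  have hρle : ∀ n, ρ n ≤ r := fun n => by
    have h : 1 / ((n : ℝ) + 1) ≤ 1 := (div_le_one (by positivity)).2 (by linarith [n.cast_nonneg (α := ℝ)])
    exact mul_le_of_le_one_right hr.le h
  have hρ0 : Tendsto ρ atTop (𝓝 0) := by
    simpa [hρ] using (tendsto_one_div_add_atTop_nhds_zero_nat (𝕜 := ℝ)).const_mul r
  choose f hf1 hf2 hf3 hf4 hf5 using fun n => exists_mollification hw (hρpos n)
  have hsub : ∀ n, tsupport (f n) ⊆ Metric.cthickening r (tsupport w) := fun n =>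
    (hf2 n).trans (Metric.cthickening_mono (hρle n) _)
  have hfcs : ∀ n, HasCompactSupport (f n) := fun n =>
    (IsCompact.cthickening hcs).of_isClosed_subset (isClosed_tsupport _) (hsub n)
  have hfL : ∀ n, MemLp (f n) 2 (volume.restrict Ω) := fun n =>
    ((hf1 n).continuous.memLp_of_hasCompactSupport (hfcs n)).restrict _
  have hgL : ∀ n, MemLp (gradient (f n)) 2 (volume.restrict Ω) := fun n =>
    ((continuous_gradient (hf1 n)).memLp_of_hasCompactSupport
      (hasCompactSupport_gradient (hfcs n))).restrict _
  have hwL : MemLp w 2 (volume.restrict Ω) :=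
    (hw.continuous.memLp_of_hasCompactSupport hcs).restrict _
  have hGL : MemLp (gradient w) 2 (volume.restrict Ω) :=
    MemLp.of_bound (measurable_gradient w).aestronglyMeasurable K
      (Eventually.of_forall (norm_gradient_le_of_lipschitz hw))
  refine ⟨WithLp.toLp 2 (hwL.toLp w, hGL.toLp (gradient w)), ?_, hwL.coeFn_toLp, hGL.coeFn_toLp⟩
  refine mem_closure_of_tendsto (b := atTop)
    (f := fun n => WithLp.toLp 2 ((hfL n).toLp (f n), (hgL n).toLp (gradient (f n)))) ?_ ?_
  · refine ((WithLp.prod_continuous_toLp 2 _ _).tendsto _).comp (Tendsto.prodMk_nhds ?_ ?_)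
    · refine tendsto_toLp_of_dominated hfL hwL (M := K * r)
        (fun n => Eventually.of_forall fun x => (hf4 n x).trans
          (mul_le_mul_of_nonneg_left (hρle n) K.2)) (Eventually.of_forall fun x => ?_)
      rw [tendsto_iff_norm_sub_tendsto_zero]
      have h0 : Tendsto (fun n => (K : ℝ) * ρ n) atTop (𝓝 0) := by simpa using hρ0.const_mul (K : ℝ)
      exact squeeze_zero (fun n => norm_nonneg _) (fun n => hf4 n x) h0
    · refine tendsto_toLp_of_dominated hgL hGL (M := K + K)
        (fun n => Eventually.of_forall fun x => (norm_sub_le _ _).trans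
          (add_le_add (norm_gradient_le_of_lipschitz (hf3 n) x)
            (norm_gradient_le_of_lipschitz hw x))) (haff.mono fun x ⟨G, hG⟩ => ?_)
      obtain ⟨τ, hτ, hball⟩ := Metric.eventually_nhds_iff_ball.1 hG
      have hwG : HasFDerivAt w G x := hasFDerivAt_of_eventuallyEq_affine hG
      -- Once twice the mollification radius is below `τ`, the gradients at `x` agree exactly.
      -- Pointwise convergence thus needs only local affinity, and dominated convergence with the
      -- Lipschitz bound does the rest.
      have hev : ∀ᶠ n in atTop, gradient (f n) x = gradient w x := by
        filter_upwards [hρ0.eventually_lt_const (half_pos hτ)] with n hn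
        have := hf5 n x G fun y hy => hball y (Metric.ball_subset_ball (by linarith) hy)
        rw [gradient, gradient, this.fderiv, hwG.fderiv]
      exact tendsto_const_nhds.congr' (hev.mono fun n hn => hn.symm)
  · refine Eventually.of_forall fun n => ?_
    exact ⟨f n, hf1 n, hfcs n, (hsub n).trans hrΩ, (hfL n).coeFn_toLp, (hgL n).coeFn_toLp⟩

end Mollification

/-! ### Interpolation error on a single simplex -/

section AffineInterpolation

variable {d : ℕ}

theorem exists_affineMap_eq_on (s : Finset (Eucl d)) (hcard : s.card = d + 1)
    (hs : AffineIndependent ℝ ((↑) : s → Eucl d)) (φ : Eucl d → ℝ) :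
    ∃ g : Eucl d →ᵃ[ℝ] ℝ, ∀ v ∈ s, g v = φ v := by
  classical
  let b : AffineBasis s ℝ (Eucl d) := ⟨(↑), hs,
    hs.affineSpan_eq_top_iff_card_eq_finrank_add_one.2 (by simp [hcard])⟩
  refine ⟨(Fintype.linearCombination ℝ fun v : s => φ v).toAffineMap.comp b.coords, fun v hv => ?_⟩
  have h : ∀ i : s, b.coord i v = if i = ⟨v, hv⟩ then 1 else 0 := fun i =>
    b.coord_apply i ⟨v, hv⟩
  simp [Fintype.linearCombination_apply, AffineBasis.coords_apply, h]

theorem AffineMap.abs_le_on_convexHull {E : Type*} [AddCommGroup E] [Module ℝ E]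
    (g : E →ᵃ[ℝ] ℝ) {s : Set E} {M : ℝ} (h : ∀ v ∈ s, |g v| ≤ M) {x : E}
    (hx : x ∈ convexHull ℝ s) : |g x| ≤ M := by
  have : convexHull ℝ s ⊆ g ⁻¹' Icc (-M) M :=
    convexHull_min (fun v hv => abs_le.1 (h v hv)) ((convex_Icc _ _).affine_preimage g)
  exact abs_le.2 (this hx)

/-- Subtracting the values at two antipodal boundary points of the ball cancels the constant part
and leaves twice the linear part. With an inscribed ball this acts as an inverse estimate. -/
theorem norm_le_of_abs_affine_le {E : Type*} [NormedAddCommGroup E] [NormedSpace ℝ E]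
    (A : E →L[ℝ] ℝ) (a : ℝ) {c : E} {r M : ℝ} (hr : 0 < r)
    (h : ∀ y ∈ Metric.closedBall c r, |a + A y| ≤ M) : ‖A‖ ≤ M / r := by
  have hM : 0 ≤ M := (abs_nonneg _).trans (h c (Metric.mem_closedBall_self hr.le))
  refine A.opNorm_le_bound (by positivity) fun e => ?_
  rcases eq_or_ne e 0 with rfl | he
  · simp
  have hne : 0 < ‖e‖ := norm_pos_iff.2 he
  set t := r / ‖e‖ with ht
  have htp : 0 < t := div_pos hr hne
  have hte : ‖t • e‖ = r := by
    rw [norm_smul, Real.norm_of_nonneg htp.le, ht, div_mul_cancel₀ _ hne.ne']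
  have h1 := h (c + t • e) (by rw [mem_closedBall_iff_norm, add_sub_cancel_left, hte])
  have h2 := h (c - t • e) (by
    rw [mem_closedBall_iff_norm, sub_sub_cancel_left, norm_neg, hte])
  have h3 : |2 * (t * A e)| ≤ 2 * M := by
    have : 2 * (t * A e) = (a + A (c + t • e)) - (a + A (c - t • e)) := by
      simp only [map_add, map_sub, map_smul, smul_eq_mul]
      ring
    rw [this]
    exact (abs_sub _ _).trans (by linarith)
  rw [abs_mul, abs_mul, abs_of_pos htp, abs_two] at h3
  rw [Real.norm_eq_abs, div_mul_eq_mul_div, le_div_iff₀ hr]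
  have h4 : r = t * ‖e‖ := by rw [ht, div_mul_cancel₀ _ hne.ne']
  rw [h4]
  nlinarith

theorem dist_le_simplexDiam {s : Finset (Eucl d)} {x y : Eucl d}
    (hx : x ∈ convexHull ℝ (s : Set (Eucl d))) (hy : y ∈ convexHull ℝ (s : Set (Eucl d))) :
    ‖x - y‖ ≤ simplexDiam s := by
  rw [← dist_eq_norm]
  exact Metric.dist_le_diam_of_mem (s.finite_toSet.isCompact_convexHull (𝕜 := ℝ)).isBounded hx hy

theorem simplexDiam_pos {s : Finset (Eucl d)} (h : 1 < s.card) : 0 < simplexDiam s := by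
  obtain ⟨a, ha, b, hb, hab⟩ := Finset.one_lt_card.1 h
  exact (norm_pos_iff.2 (sub_ne_zero.2 hab)).trans_le
    (dist_le_simplexDiam (subset_convexHull ℝ _ ha) (subset_convexHull ℝ _ hb))

theorem abs_taylor_le {φ : Eucl d → ℝ} (hφ : Differentiable ℝ φ) {K : NNReal}
    (hK : LipschitzWith K (fderiv ℝ φ)) (x y : Eucl d) :
    |φ y - φ x - fderiv ℝ φ x (y - x)| ≤ K * ‖y - x‖ ^ 2 := by
  have := (convex_closedBall x ‖y - x‖).norm_image_sub_le_of_norm_fderiv_le' (f := φ)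
    (C := K * ‖y - x‖) (φ := fderiv ℝ φ x) (x := x) (y := y) (fun z _ => hφ z) (fun z hz => ?_)
    (Metric.mem_closedBall_self (norm_nonneg _)) (by rw [mem_closedBall_iff_norm])
  · rw [Real.norm_eq_abs] at this
    exact this.trans (le_of_eq (by ring))
  · rw [← dist_eq_norm]
    exact (hK.dist_le_mul z x).trans (mul_le_mul_of_nonneg_left (Metric.mem_closedBall.1 hz) K.2)

theorem AffineMap.eq_add_linear {E : Type*} [AddCommGroup E] [Module ℝ E] (g : E →ᵃ[ℝ] ℝ)
    (x y : E) : g y = g x + g.linear (y - x) := by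
  have := g.linearMap_vsub y x
  rw [vsub_eq_sub, vsub_eq_sub] at this
  rw [this]
  ring

/-- Error of affine interpolation on a simplex that contains a ball of comparable radius. -/
theorem affine_interpolation_error {φ : Eucl d → ℝ} (hφ : Differentiable ℝ φ) {K : NNReal}
    (hK : LipschitzWith K (fderiv ℝ φ)) {s : Finset (Eucl d)} (hs : 1 < s.card) {ρ : ℝ} (hρ : 0 < ρ)
    {c : Eucl d} (hc : Metric.closedBall c (ρ * simplexDiam s) ⊆ convexHull ℝ (s : Set (Eucl d)))
    {g : Eucl d →ᵃ[ℝ] ℝ} (hg : ∀ v ∈ s, g v = φ v) {x : Eucl d}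
    (hx : x ∈ convexHull ℝ (s : Set (Eucl d))) :
    |g x - φ x| ≤ K * simplexDiam s ^ 2 ∧
      ‖LinearMap.toContinuousLinearMap g.linear - fderiv ℝ φ x‖ ≤ K * simplexDiam s / ρ := by
  have hpos := simplexDiam_pos hs
  -- The interpolant minus the Taylor polynomial of `φ` at `x`. Taylor's formula bounds it at the
  -- vertices, hence on the simplex; its value at `x` and its linear part are the two errors sought.
  set q : Eucl d →ᵃ[ℝ] ℝ := g - (AffineMap.const ℝ _ (φ x - fderiv ℝ φ x x) +
    (fderiv ℝ φ x).toLinearMap.toAffineMap) with hq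
  have hqv : ∀ y, q y = g y - (φ x + fderiv ℝ φ x (y - x)) := by
    intro y
    simp only [hq, AffineMap.coe_sub, AffineMap.coe_add, Pi.sub_apply, Pi.add_apply,
      AffineMap.const_apply, LinearMap.coe_toAffineMap, ContinuousLinearMap.coe_coe, map_sub]
    ring
  have hbd : ∀ y ∈ convexHull ℝ (s : Set (Eucl d)), |q y| ≤ K * simplexDiam s ^ 2 := by
    intro y hy
    refine AffineMap.abs_le_on_convexHull q (fun v hv => ?_) hy
    rw [hqv, hg v hv, ← sub_sub]
    refine (abs_taylor_le hφ hK x v).trans (mul_le_mul_of_nonneg_left ?_ K.2)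
    exact pow_le_pow_left₀ (norm_nonneg _) (dist_le_simplexDiam (subset_convexHull ℝ _ hv) hx) 2
  constructor
  · simpa [hqv] using hbd x hx
  · have h1 : ∀ y, q y = q 0 + (LinearMap.toContinuousLinearMap g.linear - fderiv ℝ φ x) y := by
      intro y
      rw [hqv, hqv, AffineMap.eq_add_linear g 0 y]
      simp
      ring
    have := norm_le_of_abs_affine_le (LinearMap.toContinuousLinearMap g.linear - fderiv ℝ φ x)
      (q 0) (c := c) (r := ρ * simplexDiam s) (M := K * simplexDiam s ^ 2) (by positivity)
      fun y hy => by
        rw [← h1]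
        exact hbd y (hc hy)
    refine this.trans (le_of_eq ?_)
    field_simp

end AffineInterpolation

/-! ### Nodal interpolation and density of the finite element spaces -/

section NodalInterpolation

variable {d : ℕ} {Ω : Set (Eucl d)}

theorem Mesh.simplexDiam_le_width (T : Mesh Ω) {s : Finset (Eucl d)} (hs : s ∈ T.elements) :
    simplexDiam s ≤ T.width :=
  le_csSup (T.elements.finite_toSet.image _).bddAbove (mem_image_of_mem _ hs)

/-- By conformity the point lies in the hull of the common vertices, where the difference of the two
affine pieces vanishes. -/
theorem Mesh.eq_of_mem_of_mem (T : Mesh Ω) {φ : Eucl d → ℝ}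
    {g : T.elements → Eucl d →ᵃ[ℝ] ℝ} (hg : ∀ s, ∀ v ∈ s.1, g s v = φ v) {s t : T.elements}
    {x : Eucl d} (hs : x ∈ convexHull ℝ (s.1 : Set (Eucl d)))
    (ht : x ∈ convexHull ℝ (t.1 : Set (Eucl d))) : g s x = g t x := by
  have h := AffineMap.abs_le_on_convexHull (g s - g t) (M := 0) (fun v hv => by
    simp [hg s v hv.1, hg t v hv.2]) (T.conforming s.1 s.2 t.1 t.2 ⟨hs, ht⟩)
  rw [AffineMap.coe_sub, Pi.sub_apply] at h
  exact sub_eq_zero.1 (abs_eq_zero.1 (le_antisymm h (abs_nonneg _)))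

/-- The nodal interpolant on a mesh, extended by zero. -/
theorem Mesh.exists_interpolant (T : Mesh Ω) (φ : Eucl d → ℝ) :
    ∃ (g : T.elements → Eucl d →ᵃ[ℝ] ℝ) (w : Eucl d → ℝ), (∀ s, ∀ v ∈ s.1, g s v = φ v) ∧
      (∀ s, ∀ x ∈ convexHull ℝ (s.1 : Set (Eucl d)), w x = g s x) ∧
      (∀ x ∉ closure Ω, w x = 0) := by
  classical
  choose g hg using fun s : T.elements =>
    exists_affineMap_eq_on s.1 (T.card_eq s.1 s.2) (T.affineIndependent s.1 s.2) φ
  refine ⟨g, fun x => if h : ∃ s : T.elements, x ∈ convexHull ℝ (s.1 : Set (Eucl d)) then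
    g h.choose x else 0, hg, fun s x hx => ?_, fun x hx => ?_⟩
  · have h : ∃ s : T.elements, x ∈ convexHull ℝ (s.1 : Set (Eucl d)) := ⟨s, hx⟩
    simp only [dif_pos h]
    exact T.eq_of_mem_of_mem hg h.choose_spec hx
  · refine dif_neg fun ⟨s, hs⟩ => hx ?_
    rw [T.covers]
    exact mem_iUnion₂.2 ⟨s.1, s.2, hs⟩

/-- On shape-regular meshes the finite element spaces approximate test functions in `H¹(Ω)`. -/
theorem exists_mem_space_near_testPair (hd : 1 ≤ d) (hΩo : IsOpen Ω)
    (hΩ : Bornology.IsBounded Ω) {ρ : ℝ} (hρ : 0 < ρ) {q : GradPair Ω} (hq : q ∈ testPairs Ω) :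
    ∃ C > 0, ∃ h₀ > 0, ∀ T : Mesh Ω,
      (∀ s ∈ T.elements, ∃ x : Eucl d,
        Metric.closedBall x (ρ * simplexDiam s) ⊆ convexHull ℝ (s : Set (Eucl d))) →
      T.width < h₀ → ∃ p ∈ T.space, ‖p - q‖ ≤ C * T.width := by
  have := isFiniteMeasure_restrict hΩ
  obtain ⟨φ, h1, h2, h3, h4, h5⟩ := hq
  have hφd : Differentiable ℝ φ := h1.differentiable (by simp)
  obtain ⟨K₁, hK₁⟩ := h1.lipschitzWith_of_hasCompactSupport h2 (by simp)
  obtain ⟨K₂, hK₂⟩ := (h1.fderiv_right (m := ∞) (by simp)).lipschitzWith_of_hasCompactSupport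
    (h2.fderiv ℝ) (by simp)
  obtain ⟨r, hr, hrΩ⟩ := h2.exists_cthickening_subset_open hΩo h3
  set m : ℝ := (measureUnivNNReal (volume.restrict Ω) : ℝ) ^ (2 : ENNReal).toReal⁻¹ with hm
  have hm0 : 0 ≤ m := by positivity
  -- Here `m` is $|\Omega|^{1/2}$, which turns uniform bounds into `L²` bounds. A width below `r`
  -- keeps the support of the interpolant inside `Ω`; a width below `1` bounds its Lipschitz
  -- constant.
  refine ⟨m * K₂ + m * (K₂ / ρ) + 1, by positivity, min r 1, by positivity, fun T hT hTw => ?_⟩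
  obtain ⟨hTr, hT1⟩ := lt_min_iff.1 hTw
  obtain ⟨g, w, hg, hw, hw0⟩ := T.exists_interpolant φ
  have hcard : ∀ s : T.elements, 1 < s.1.card := fun s => by
    rw [T.card_eq s.1 s.2]; omega
  have hcov : ∀ x ∈ closure Ω, ∃ s : T.elements, x ∈ convexHull ℝ (s.1 : Set (Eucl d)) := by
    intro x hx
    rw [T.covers] at hx
    obtain ⟨s, hs, hxs⟩ := mem_iUnion₂.1 hx
    exact ⟨⟨s, hs⟩, hxs⟩
  have hdiam : ∀ s : T.elements, simplexDiam s.1 ≤ T.width := fun s => T.simplexDiam_le_width s.2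
  have hdpos : ∀ s : T.elements, 0 < simplexDiam s.1 := fun s => simplexDiam_pos (hcard s)
  have herr : ∀ s : T.elements, ∀ x ∈ convexHull ℝ (s.1 : Set (Eucl d)),
      |g s x - φ x| ≤ K₂ * T.width ∧
      ‖LinearMap.toContinuousLinearMap (g s).linear - fderiv ℝ φ x‖ ≤ K₂ / ρ * T.width := by
    intro s x hx
    obtain ⟨c, hc⟩ := hT s.1 s.2
    obtain ⟨e1, e2⟩ := affine_interpolation_error hφd hK₂ (hcard s) hρ hc (hg s) hx
    refine ⟨e1.trans (mul_le_mul_of_nonneg_left ?_ K₂.2), e2.trans ?_⟩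
    · have := hdiam s
      have := hdpos s
      nlinarith
    · rw [div_mul_eq_mul_div]
      exact div_le_div_of_nonneg_right (mul_le_mul_of_nonneg_left (hdiam s) K₂.2) hρ.le
  -- A simplex on which the interpolant is not zero has a vertex in the support of `φ`, at distance
  -- at most its diameter.
  have hne : ∀ x, w x ≠ 0 → x ∈ Metric.cthickening T.width (tsupport φ) := by
    intro x hx
    obtain ⟨s, hs⟩ := hcov x (by_contra fun h => hx (hw0 x h))
    have hv : ∃ v ∈ s.1, φ v ≠ 0 := by
      by_contra! hv
      have := AffineMap.abs_le_on_convexHull (g s) (M := 0)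
        (fun v hv' => by simp [hg s v hv', hv v hv']) hs
      exact hx (by rw [hw s x hs]; exact abs_eq_zero.1 (le_antisymm this (abs_nonneg _)))
    obtain ⟨v, hvs, hv⟩ := hv
    refine Metric.mem_cthickening_of_dist_le x v _ _ (subset_tsupport _ hv) ?_
    rw [dist_eq_norm]
    exact (dist_le_simplexDiam hs (subset_convexHull ℝ _ hvs)).trans (hdiam s)
  have hsupp : tsupport w ⊆ Ω := (closure_minimal hne Metric.isClosed_cthickening).trans
    ((Metric.cthickening_mono hTr.le _).trans hrΩ)
  have hlin : ∀ (s : T.elements) (x y : Eucl d),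
      g s y = g s x + LinearMap.toContinuousLinearMap (g s).linear (y - x) :=
    fun s x y => AffineMap.eq_add_linear (g s) x y
  set L : NNReal := K₁ + K₂ / Real.toNNReal ρ with hL
  have hLip : LipschitzWith L w := by
    refine LipschitzWith.of_dist_le_mul fun x y => ?_
    rw [Real.dist_eq, dist_eq_norm]
    -- The index `none` is the closure of the exterior of `closure Ω`. It is disjoint from the open
    -- set `Ω`, which contains the support of `w`, so `w` vanishes there.
    refine abs_sub_le_of_finite_closed_cover (ι := Option T.elements)
      (A := fun o => o.elim (closure (closure Ω)ᶜ) fun s => convexHull ℝ (s.1 : Set (Eucl d)))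
      ?_ ?_ L.2 ?_ x y
    · rintro (_ | s)
      · exact isClosed_closure
      · exact (s.1.finite_toSet.isCompact_convexHull (𝕜 := ℝ)).isClosed
    · refine eq_univ_of_forall fun x => mem_iUnion.2 ?_
      by_cases hx : x ∈ closure Ω
      · obtain ⟨s, hs⟩ := hcov x hx
        exact ⟨some s, hs⟩
      · exact ⟨none, subset_closure hx⟩
    · rintro (_ | s) x hx y hy
      · have hz : ∀ x ∈ closure (closure Ω)ᶜ, w x = 0 := by
          intro x hx
          by_contra hne
          have hxΩ : x ∈ Ω := hsupp (subset_tsupport _ hne)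
          obtain ⟨z, hzΩ, hz⟩ := mem_closure_iff.1 hx Ω hΩo hxΩ
          exact hz (subset_closure hzΩ)
        rw [hz x hx, hz y hy, sub_zero, abs_zero]
        exact mul_nonneg L.2 (norm_nonneg _)
      · have hG : ‖LinearMap.toContinuousLinearMap (g s).linear‖ ≤ L := by
          have a1 := (herr s x hx).2
          have a2 := norm_fderiv_le_of_lipschitz ℝ hK₁ (x₀ := x)
          have a3 := norm_le_norm_sub_add (LinearMap.toContinuousLinearMap (g s).linear)
            (fderiv ℝ φ x)
          have a4 : (K₂ : ℝ) / ρ * T.width ≤ K₂ / ρ :=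
            mul_le_of_le_one_right (by positivity) hT1.le
          have a5 : (L : ℝ) = K₁ + K₂ / ρ := by simp [hL, hρ.le]
          linarith
        rw [hw s x hx, hw s y hy, hlin s y x, add_sub_cancel_left, ← Real.norm_eq_abs]
        exact ContinuousLinearMap.le_of_opNorm_le _ hG _
  -- Boundaries of convex sets are null sets, so almost every point is interior to a simplex and `w`
  -- is affine around it.
  have hint : ∀ᵐ x ∂(volume.restrict Ω), ∃ s : T.elements,
      x ∈ interior (convexHull ℝ (s.1 : Set (Eucl d))) := by
    have hfr : ∀ s : T.elements, ∀ᵐ x ∂(volume.restrict Ω),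
        x ∉ frontier (convexHull ℝ (s.1 : Set (Eucl d))) := fun s =>
      ae_restrict_of_ae (measure_eq_zero_iff_ae_notMem.1
        ((convex_convexHull ℝ _).addHaar_frontier volume))
    filter_upwards [eventually_countable_forall.2 hfr, ae_restrict_mem hΩo.measurableSet]
      with x hx hxΩ
    obtain ⟨s, hs⟩ := hcov x (subset_closure hxΩ)
    refine ⟨s, by_contra fun h => hx s ⟨subset_closure hs, h⟩⟩
  have hloc : ∀ (s : T.elements) x, x ∈ interior (convexHull ℝ (s.1 : Set (Eucl d))) →
      ∀ᶠ y in 𝓝 x, w y = w x + LinearMap.toContinuousLinearMap (g s).linear (y - x) := by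
    intro s x hx
    filter_upwards [mem_interior_iff_mem_nhds.1 hx] with y hy
    rw [hw s y hy, hw s x (interior_subset hx), hlin s x y]
  obtain ⟨p, hp, hpf, hpg⟩ := exists_mem_H10_of_lipschitz hΩo hΩ hLip hsupp
    (hint.mono fun x ⟨s, hs⟩ => ⟨_, hloc s x hs⟩)
  have hw0' : 0 ≤ T.width := by
    rcases T.elements.eq_empty_or_nonempty with h | ⟨s, hs⟩
    · simp [Mesh.width, h]
    · exact (hdpos ⟨s, hs⟩).le.trans (hdiam ⟨s, hs⟩)
  refine ⟨p, ⟨hp, fun s hs => ⟨g ⟨s, hs⟩, hpf.mono fun x hx hxs => hx.trans (hw ⟨s, hs⟩ x hxs)⟩⟩, ?_⟩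
  have b1 : ‖(p - q).fst‖ ≤ m * (K₂ * T.width) := by
    refine Lp.norm_le_of_ae_bound (by positivity) ?_
    filter_upwards [Lp.coeFn_sub p.fst q.fst, hpf, h4, hint] with x a1 a2 a3 ⟨s, hs⟩
    have a4 : (p - q).fst x = p.fst x - q.fst x := a1
    rw [a4, a2, a3, hw s x (interior_subset hs)]
    exact (herr s x (interior_subset hs)).1
  have b2 : ‖(p - q).snd‖ ≤ m * (K₂ / ρ * T.width) := by
    refine Lp.norm_le_of_ae_bound (by positivity) ?_
    filter_upwards [Lp.coeFn_sub p.snd q.snd, hpg, h5, hint] with x a1 a2 a3 ⟨s, hs⟩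
    have a4 : (p - q).snd x = p.snd x - q.snd x := a1
    have a5 : HasFDerivAt w (LinearMap.toContinuousLinearMap (g s).linear) x :=
      hasFDerivAt_of_eventuallyEq_affine (hloc s x hs)
    rw [a4, a2, a3, gradient, gradient, ← map_sub, LinearIsometryEquiv.norm_map, a5.fderiv]
    exact (herr s x (interior_subset hs)).2
  have b3 : ‖p - q‖ ≤ ‖(p - q).fst‖ + ‖(p - q).snd‖ := by
    refine le_of_sq_le_sq ?_ (by positivity)
    rw [norm_sq_gradPair]
    nlinarith [norm_nonneg (p - q).fst, norm_nonneg (p - q).snd]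
  nlinarith

/-- On a shape-regular family of meshes the spaces `V_h` become dense in `H₀¹(Ω)` as `h → 0`. -/
theorem eventually_exists_mem_space_near (hd : 1 ≤ d) (hΩo : IsOpen Ω)
    (hΩ : Bornology.IsBounded Ω) {ι : Type*} {l : Filter ι} {T : ι → Mesh Ω}
    (hTs : ShapeRegular T) (hTw : Tendsto (fun i => (T i).width) l (𝓝 0))
    {y : GradPair Ω} (hy : y ∈ H10 Ω) {η : ℝ} (hη : 0 < η) :
    ∀ᶠ i in l, ∃ v ∈ (T i).space, ‖v - y‖ < η := by
  obtain ⟨ρ, hρ, hT⟩ := hTs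
  obtain ⟨q, hq, hqy⟩ := Metric.mem_closure_iff.1 hy (η / 2) (half_pos hη)
  obtain ⟨C, hC, h₀, hh₀, H⟩ := exists_mem_space_near_testPair hd hΩo hΩ hρ hq
  filter_upwards [hTw.eventually_lt_const hh₀,
    hTw.eventually_lt_const (div_pos (half_pos hη) hC)] with i hi hi'
  obtain ⟨p, hp, hpq⟩ := H (T i) (hT i) hi
  refine ⟨p, hp, ?_⟩
  rw [lt_div_iff₀ hC] at hi'
  rw [dist_eq_norm, norm_sub_rev] at hqy
  have := norm_sub_le_norm_sub_add_norm_sub p q y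
  linarith

end NodalInterpolation

/-! ### Approximation by averages over cubic cells -/

section CellAverages

variable {d : ℕ} {Ω : Set (Eucl d)}

theorem eLpNorm_two_sq {α F : Type*} [MeasurableSpace α] {μ : Measure α} [NormedAddCommGroup F]
    (f : α → F) : eLpNorm f 2 μ ^ 2 = ∫⁻ x, ‖f x‖ₑ ^ 2 ∂μ := by
  have := eLpNorm_nnreal_pow_eq_lintegral (μ := μ) (f := f) (p := 2) two_ne_zero
  simpa using this

theorem enorm_integral_sq_le {α F : Type*} [MeasurableSpace α] {μ : Measure α}
    [IsProbabilityMeasure μ] [NormedAddCommGroup F] [NormedSpace ℝ F] {f : α → F}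
    (hf : AEStronglyMeasurable f μ) : ‖∫ x, f x ∂μ‖ₑ ^ 2 ≤ ∫⁻ x, ‖f x‖ₑ ^ 2 ∂μ := by
  rw [← eLpNorm_two_sq]
  gcongr
  refine (enorm_integral_le_lintegral_enorm f).trans ?_
  rw [← eLpNorm_one_eq_lintegral_enorm]
  exact eLpNorm_le_eLpNorm_of_exponent_le one_le_two hf

theorem enorm_gradient_eq (φ : Eucl d → ℝ) (x : Eucl d) :
    ‖gradient φ x‖ₑ = ‖fderiv ℝ φ x‖ₑ := by
  rw [← ofReal_norm, ← ofReal_norm, norm_gradient_eq]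

/-- The difference quotient estimate for translations in `L²`. -/
theorem lintegral_translation_sub_le {φ : Eucl d → ℝ} (hφ : ContDiff ℝ ∞ φ) (z : Eucl d) :
    ∫⁻ x, ‖φ (x + z) - φ x‖ₑ ^ 2 ≤ ‖z‖ₑ ^ 2 * ∫⁻ x, ‖gradient φ x‖ₑ ^ 2 := by
  have hcont : Continuous fun p : Eucl d × ℝ => fderiv ℝ φ (p.1 + p.2 • z) :=
    (hφ.continuous_fderiv (by simp)).comp (by fun_prop)
  -- The increment is the integral of the derivative along the segment, and Jensen's inequality
  -- moves the square inside. Integrating in `x` then removes the translation.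
  have hpt : ∀ x, ‖φ (x + z) - φ x‖ₑ ^ 2 ≤
      ∫⁻ t in Ioc (0 : ℝ) 1, ‖z‖ₑ ^ 2 * ‖gradient φ (x + t • z)‖ₑ ^ 2 := by
    intro x
    have hc : Continuous fun t : ℝ => fderiv ℝ φ (x + t • z) z :=
      (hcont.comp (by fun_prop : Continuous fun t : ℝ => (x, t))).clm_apply continuous_const
    have hder : ∀ t : ℝ, HasDerivAt (fun t : ℝ => φ (x + t • z)) (fderiv ℝ φ (x + t • z) z) t := by
      intro t
      have h1 : HasDerivAt (fun t : ℝ => x + t • z) z t := by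
        simpa using ((hasDerivAt_id t).smul_const z).const_add x
      exact ((hφ.differentiable (by simp)) _).hasFDerivAt.comp_hasDerivAt t h1
    have hint : ∫ t in (0 : ℝ)..1, fderiv ℝ φ (x + t • z) z = φ (x + z) - φ x := by
      rw [intervalIntegral.integral_eq_sub_of_hasDerivAt (fun t _ => hder t)
        (hc.intervalIntegrable _ _)]
      simp
    rw [intervalIntegral.integral_of_le zero_le_one] at hint
    have : IsProbabilityMeasure (volume.restrict (Ioc (0 : ℝ) 1)) := ⟨by simp⟩
    rw [← hint]
    refine (enorm_integral_sq_le hc.aestronglyMeasurable).trans (lintegral_mono fun t => ?_)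
    rw [← mul_pow, enorm_gradient_eq, mul_comm]
    gcongr
    exact ContinuousLinearMap.le_opENorm _ _
  have hgc : Measurable fun p : Eucl d × ℝ => ‖gradient φ (p.1 + p.2 • z)‖ₑ ^ 2 :=
    ((continuous_gradient hφ).comp (by fun_prop)).enorm.measurable.pow_const 2
  calc ∫⁻ x, ‖φ (x + z) - φ x‖ₑ ^ 2
      ≤ ∫⁻ x, ∫⁻ t in Ioc (0 : ℝ) 1, ‖z‖ₑ ^ 2 * ‖gradient φ (x + t • z)‖ₑ ^ 2 :=
        lintegral_mono hpt
    _ = ∫⁻ t in Ioc (0 : ℝ) 1, ∫⁻ x, ‖z‖ₑ ^ 2 * ‖gradient φ (x + t • z)‖ₑ ^ 2 :=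
        lintegral_lintegral_swap (hgc.const_mul (‖z‖ₑ ^ 2)).aemeasurable
    _ = ∫⁻ _t in Ioc (0 : ℝ) 1, ‖z‖ₑ ^ 2 * ∫⁻ x, ‖gradient φ x‖ₑ ^ 2 := by
        refine lintegral_congr fun t => ?_
        rw [lintegral_const_mul' _ _ (by simp)]
        exact congrArg _ (lintegral_add_right_eq_self (fun x => ‖gradient φ x‖ₑ ^ 2) (t • z))
    _ = ‖z‖ₑ ^ 2 * ∫⁻ x, ‖gradient φ x‖ₑ ^ 2 := by simp

/-- Poincaré inequality for averages over the cells of a partition `c`. -/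
theorem lintegral_sub_average_le {κ : Type*} {c : Eucl d → κ}
    {ρ : ℝ} {V₀ : ENNReal} (hV : V₀ ≠ 0)
    (hQ : ∀ x, c ⁻¹' {c x} ⊆ Metric.closedBall x ρ) (hQV : ∀ x, V₀ ≤ volume (c ⁻¹' {c x}))
    {φ : Eucl d → ℝ} (hφ : ContDiff ℝ ∞ φ) (hs : HasCompactSupport φ) :
    ∫⁻ x, ‖φ x - ⨍ y in c ⁻¹' {c x}, φ y‖ₑ ^ 2 ≤
      V₀⁻¹ * (volume (Metric.closedBall (0 : Eucl d) ρ) *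
        (ENNReal.ofReal ρ ^ 2 * ∫⁻ x, ‖gradient φ x‖ₑ ^ 2)) := by
  -- After Jensen's inequality on the cell, enlarging the cell to a ball centred at `x` makes the
  -- domain of increments `z` independent of `x`, so the integrals can be swapped.
  have hpt : ∀ x, ‖φ x - ⨍ y in c ⁻¹' {c x}, φ y‖ₑ ^ 2 ≤
      V₀⁻¹ * ∫⁻ z in Metric.closedBall (0 : Eucl d) ρ, ‖φ (x + z) - φ x‖ₑ ^ 2 := by
    intro x
    set Q := c ⁻¹' {c x} with hQdef
    have h0 : volume Q ≠ 0 := fun h => hV (le_antisymm (h ▸ hQV x) bot_le)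
    have ht : volume Q ≠ ⊤ :=
      ((measure_mono (hQ x)).trans_lt Metric.isBounded_closedBall.measure_lt_top).ne
    have hfin : IsFiniteMeasure (volume.restrict Q) := ⟨by simpa using ht.lt_top⟩
    have hne : NeZero (volume.restrict Q) := ⟨by simpa using h0⟩
    have hI : Integrable φ (volume.restrict Q) :=
      (hφ.continuous.integrable_of_hasCompactSupport hs).restrict
    have h1 : φ x - ⨍ y in Q, φ y = ⨍ y in Q, (φ x - φ y) := by
      have h := setAverage_const h0 ht (φ x)
      rw [setAverage_eq] at h
      rw [setAverage_eq, setAverage_eq, integral_sub (integrable_const _) hI, smul_sub, h]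
    rw [h1, average]
    refine (enorm_integral_sq_le
      (continuous_const.sub hφ.continuous).aestronglyMeasurable).trans ?_
    rw [lintegral_smul_measure, Measure.restrict_apply_univ, smul_eq_mul]
    have hm : Measurable fun y => ‖φ y - φ x‖ₑ ^ 2 :=
      (hφ.continuous.sub continuous_const).enorm.measurable.pow_const 2
    have h2 := (measurePreserving_add_left volume x).setLIntegral_comp_preimage
      (s := Metric.closedBall x ρ) Metric.isClosed_closedBall.measurableSet hm
    have h3 : (fun z => x + z) ⁻¹' Metric.closedBall x ρ = Metric.closedBall 0 ρ := by
      ext z; simp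
    rw [h3] at h2
    rw [h2]
    refine mul_le_mul' (ENNReal.inv_le_inv.2 (hQV x)) ?_
    refine (lintegral_mono_set (hQ x)).trans (le_of_eq (lintegral_congr fun y => ?_))
    rw [← enorm_neg]
    congr 2
    exact neg_sub _ _
  have hm : Measurable fun p : Eucl d × Eucl d => ‖φ (p.1 + p.2) - φ p.1‖ₑ ^ 2 :=
    ((hφ.continuous.comp (continuous_fst.add continuous_snd)).sub
      (hφ.continuous.comp continuous_fst)).enorm.measurable.pow_const 2
  have hVinv : V₀⁻¹ ≠ ⊤ := ENNReal.inv_ne_top.2 hV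
  calc ∫⁻ x, ‖φ x - ⨍ y in c ⁻¹' {c x}, φ y‖ₑ ^ 2
      ≤ ∫⁻ x, V₀⁻¹ * ∫⁻ z in Metric.closedBall (0 : Eucl d) ρ, ‖φ (x + z) - φ x‖ₑ ^ 2 :=
        lintegral_mono hpt
    _ = V₀⁻¹ * ∫⁻ z in Metric.closedBall (0 : Eucl d) ρ, ∫⁻ x, ‖φ (x + z) - φ x‖ₑ ^ 2 := by
        rw [lintegral_const_mul' _ _ hVinv, lintegral_lintegral_swap hm.aemeasurable]
    _ ≤ V₀⁻¹ * ∫⁻ _z in Metric.closedBall (0 : Eucl d) ρ,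
          ENNReal.ofReal ρ ^ 2 * ∫⁻ x, ‖gradient φ x‖ₑ ^ 2 := by
        refine mul_le_mul' le_rfl (setLIntegral_mono measurable_const fun z hz => ?_)
        refine (lintegral_translation_sub_le hφ z).trans ?_
        gcongr
        rw [← ofReal_norm]
        exact ENNReal.ofReal_le_ofReal (mem_closedBall_zero_iff.1 hz)
    _ = _ := by
        rw [setLIntegral_const]
        ring

/-- The index of the cubic cell of side length `η` that contains a point. -/
def cellIndex (η : ℝ) (x : Eucl d) : Fin d → ℤ := fun i => ⌊x i / η⌋

theorem measurable_cellIndex (η : ℝ) : Measurable (cellIndex η : Eucl d → Fin d → ℤ) := by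
  refine measurable_pi_iff.2 fun i => Int.measurable_floor.comp ?_
  exact (by fun_prop : Continuous fun x : Eucl d => x i / η).measurable

theorem cell_subset_closedBall {η : ℝ} (hη : 0 < η) (x : Eucl d) :
    cellIndex η ⁻¹' {cellIndex η x} ⊆ Metric.closedBall x (d * η) := by
  intro y hy
  have hi : ∀ i, |y i - x i| ≤ η := by
    intro i
    have h : ⌊y i / η⌋ = ⌊x i / η⌋ := congrFun hy i
    have := Int.abs_sub_lt_one_of_floor_eq_floor h
    rw [← sub_div, abs_div, abs_of_pos hη, div_lt_one hη] at this
    exact this.le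
  rw [mem_closedBall_iff_norm]
  refine le_of_sq_le_sq ?_ (by positivity)
  rw [EuclideanSpace.norm_sq_eq]
  have h1 : ∑ i : Fin d, ‖(y - x) i‖ ^ 2 ≤ ∑ _i : Fin d, η ^ 2 :=
    Finset.sum_le_sum fun i _ => pow_le_pow_left₀ (norm_nonneg _) (hi i) 2
  refine h1.trans ?_
  rw [Finset.sum_const, Finset.card_univ, Fintype.card_fin, nsmul_eq_mul, mul_pow]
  have h2 : (d : ℝ) ≤ (d : ℝ) ^ 2 := by exact_mod_cast Nat.le_self_pow two_ne_zero d
  exact mul_le_mul_of_nonneg_right h2 (by positivity)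

theorem closedBall_subset_cell {η : ℝ} (hη : 0 < η) (x : Eucl d) :
    ∃ m : Eucl d, Metric.closedBall m (η / 4) ⊆ cellIndex η ⁻¹' {cellIndex η x} := by
  -- The centre of the cube; a radius strictly below `η / 2` avoids its half-open boundary.
  refine ⟨WithLp.toLp 2 fun i => (cellIndex η x i + 1 / 2) * η, fun y hy => ?_⟩
  funext i
  have h1 := (PiLp.norm_apply_le (y - WithLp.toLp 2 fun i => (cellIndex η x i + 1 / 2) * η) i).trans
    (mem_closedBall_iff_norm.1 hy)
  rw [PiLp.sub_apply, Real.norm_eq_abs, abs_le] at h1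
  obtain ⟨h2, h3⟩ := h1
  simp only at h2 h3
  change ⌊y i / η⌋ = cellIndex η x i
  rw [Int.floor_eq_iff, le_div_iff₀ hη, div_lt_iff₀ hη]
  constructor <;> nlinarith

theorem lintegral_sub_cell_average_le (hd : 1 ≤ d) {η : ℝ} (hη : 0 < η) {φ : Eucl d → ℝ}
    (hφ : ContDiff ℝ ∞ φ) (hs : HasCompactSupport φ) :
    ∫⁻ x, ‖φ x - ⨍ y in cellIndex η ⁻¹' {cellIndex η x}, φ y‖ₑ ^ 2 ≤
      ENNReal.ofReal ((4 * d) ^ d * (d * η) ^ 2) * ∫⁻ x, ‖gradient φ x‖ₑ ^ 2 := by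
  set V₀ := volume (Metric.closedBall (0 : Eucl d) (η / 4)) with hV₀
  have hV0 : V₀ ≠ 0 := (Metric.measure_closedBall_pos volume _ (by positivity)).ne'
  have hVt : V₀ ≠ ⊤ := Metric.isBounded_closedBall.measure_lt_top.ne
  have h := lintegral_sub_average_le (c := cellIndex η) (ρ := d * η) (V₀ := V₀)
    hV0 (cell_subset_closedBall hη) (fun x => by
      obtain ⟨m, hm⟩ := closedBall_subset_cell hη x
      refine le_trans (le_of_eq ?_) (measure_mono hm)
      rw [hV₀, Measure.addHaar_closedBall_center volume m]) hφ hs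
  refine h.trans (le_of_eq ?_)
  -- The radii of the outer and inner balls have ratio `4 * d`; this factor does not depend on `η`.
  have hvol : volume (Metric.closedBall (0 : Eucl d) (d * η)) =
      V₀ * ENNReal.ofReal ((4 * d) ^ d) := by
    rw [hV₀, Measure.addHaar_closedBall _ _ (by positivity),
      Measure.addHaar_closedBall _ _ (by positivity), mul_right_comm,
      ← ENNReal.ofReal_mul (by positivity), finrank_euclideanSpace_fin, ← mul_pow]
    congr 3
    ring
  rw [hvol, ENNReal.ofReal_mul (by positivity : (0 : ℝ) ≤ (4 * d) ^ d),
    ← ENNReal.ofReal_pow (by positivity), mul_assoc V₀, ← mul_assoc V₀⁻¹, ENNReal.inv_mul_cancel hV0 hVt, one_mul, mul_assoc]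

end CellAverages

/-! ### Compact embedding by finite-rank projections -/

section FiniteRankApproximation

variable {d : ℕ} {Ω : Set (Eucl d)}

theorem finite_cellIndex_image (hΩ : Bornology.IsBounded Ω) {η : ℝ} (hη : 0 < η) :
    (cellIndex η '' Ω).Finite := by
  obtain ⟨R, hR0, hR⟩ := hΩ.exists_pos_norm_le
  refine (Set.finite_Icc (fun _ : Fin d => ⌊-R / η⌋) fun _ : Fin d => ⌊R / η⌋).subset ?_
  rintro _ ⟨x, hx, rfl⟩
  have hxi : ∀ i, |x i| ≤ R := fun i => (PiLp.norm_apply_le x i).trans (hR x hx)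
  exact ⟨fun i => Int.floor_le_floor (div_le_div_of_nonneg_right (abs_le.1 (hxi i)).1 hη.le),
    fun i => Int.floor_le_floor (div_le_div_of_nonneg_right (abs_le.1 (hxi i)).2 hη.le)⟩

open scoped Classical in
/-- The function with value `α k` on the cell with index `k ∈ F` and zero on the other cells. -/
def cellFun {κ : Type*} {F : Set κ} (α : F → ℝ) (k : κ) : ℝ := if h : k ∈ F then α ⟨k, h⟩ else 0

theorem cellFun_add {κ : Type*} {F : Set κ} (α β : F → ℝ) (k : κ) :
    cellFun (α + β) k = cellFun α k + cellFun β k := by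
  unfold cellFun
  split_ifs <;> simp

theorem cellFun_smul {κ : Type*} {F : Set κ} (t : ℝ) (α : F → ℝ) (k : κ) :
    cellFun (t • α) k = t • cellFun α k := by
  unfold cellFun
  split_ifs <;> simp

theorem memLp_cellFun [IsFiniteMeasure (volume.restrict Ω)] (η : ℝ) {F : Set (Fin d → ℤ)}
    [Fintype F] (α : F → ℝ) :
    MemLp (fun x => cellFun α (cellIndex η x)) 2 (volume.restrict Ω) := by
  have hm : Measurable fun x : Eucl d => cellFun α (cellIndex η x) :=
    (Measurable.of_discrete (f := cellFun α)).comp (measurable_cellIndex η)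
  refine MemLp.of_bound hm.aestronglyMeasurable (∑ k, |α k|) (Eventually.of_forall fun x => ?_)
  unfold cellFun
  split_ifs with h
  · exact Finset.single_le_sum (f := fun k => |α k|) (fun _ _ => abs_nonneg _) (Finset.mem_univ _)
  · rw [norm_zero]
    exact Finset.sum_nonneg fun _ _ => abs_nonneg _

/-- Cellwise constant functions as elements of `L²(Ω)`. -/
def cellToL2 [IsFiniteMeasure (volume.restrict Ω)] (η : ℝ) (F : Set (Fin d → ℤ)) [Fintype F] :
    (F → ℝ) →ₗ[ℝ] L2 Ω where
  toFun α := (memLp_cellFun η α).toLp _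
  map_add' α β := by
    rw [← MemLp.toLp_add]
    exact MemLp.toLp_congr _ _ (Eventually.of_forall fun x => cellFun_add α β _)
  map_smul' t α := by
    rw [RingHom.id_apply, ← MemLp.toLp_const_smul]
    exact MemLp.toLp_congr _ _ (Eventually.of_forall fun x => cellFun_smul t α _)

theorem norm_sub_starProjection_le {E : Type*} [NormedAddCommGroup E] [InnerProductSpace ℝ E]
    (X : Submodule ℝ E) [X.HasOrthogonalProjection] (y : E) {x : E} (hx : x ∈ X) :
    ‖y - X.starProjection y‖ ≤ ‖y - x‖ := by
  rw [Submodule.starProjection_minimal]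
  exact ciInf_le ⟨0, by rintro _ ⟨z, rfl⟩; exact norm_nonneg _⟩ (⟨x, hx⟩ : X)

/-- Compactness of the embedding of `H₀¹(Ω)` into `L²(Ω)`: it is approximated by projections onto
finite-dimensional spaces. -/
theorem exists_finiteDimensional_approx (hd : 1 ≤ d) (hΩo : IsOpen Ω)
    (hΩ : Bornology.IsBounded Ω) {τ : ℝ} (hτ : 0 < τ) :
    ∃ (X : Submodule ℝ (L2 Ω)) (_ : FiniteDimensional ℝ X),
      ∀ v ∈ H10 Ω, ‖v.fst - X.starProjection v.fst‖ ≤ τ * ‖v.snd‖ := by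
  have := isFiniteMeasure_restrict hΩ
  have hd0 : (0 : ℝ) < d := by exact_mod_cast hd
  -- Chosen so that the cell estimate with side length `τ / κ` has constant exactly `τ ^ 2`.
  set κ : ℝ := Real.sqrt ((4 * d) ^ d) * d with hκ
  have hκ0 : 0 < κ := by positivity
  set η : ℝ := τ / κ with hη
  have hη0 : 0 < η := by positivity
  have hconst : (4 * (d : ℝ)) ^ d * (d * η) ^ 2 = τ ^ 2 := by
    have h1 : κ ^ 2 = (4 * (d : ℝ)) ^ d * d ^ 2 := by
      rw [hκ, mul_pow, Real.sq_sqrt (by positivity)]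
    have h2 : κ * η = τ := by rw [hη]; field_simp
    rw [← h2, mul_pow κ η, h1]
    ring
  set F := cellIndex η '' Ω with hF
  have : Fintype F := (finite_cellIndex_image hΩ hη0).fintype
  refine ⟨LinearMap.range (cellToL2 (Ω := Ω) η F), inferInstance, fun v hv => ?_⟩
  refine mem_H10_of_closed (P := fun v => ‖v.fst -
    (LinearMap.range (cellToL2 (Ω := Ω) η F)).starProjection v.fst‖ ≤ τ * ‖v.snd‖) ?_ ?_ hv
  · have hc : Continuous fun v : GradPair Ω => v.fst := continuous_gradPair_fst
    exact isClosed_le (hc.sub ((ContinuousLinearMap.continuous _).comp hc)).norm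
      (continuous_const.mul continuous_gradPair_snd.norm)
  rintro v ⟨φ, h1, h2, h3, h4, h5⟩
  set a : (Fin d → ℤ) → ℝ := fun k => ⨍ y in cellIndex η ⁻¹' {k}, φ y with ha
  -- The orthogonal projection is the best approximation, hence no worse than the cell averages.
  -- Using it makes the estimate a closed condition on `v`, which extends from test functions to
  -- `H10 Ω`.
  refine (norm_sub_starProjection_le _ v.fst
    (LinearMap.mem_range_self (cellToL2 (Ω := Ω) η F) fun k => a k)).trans ?_
  have hae : cellToL2 (Ω := Ω) η F (fun k => a k) =ᵐ[volume.restrict Ω]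
      fun x => a (cellIndex η x) := by
    have h6 : cellToL2 (Ω := Ω) η F (fun k => a k) =ᵐ[volume.restrict Ω]
        fun x => cellFun (F := F) (fun k => a k) (cellIndex η x) :=
      (memLp_cellFun η _).coeFn_toLp
    filter_upwards [h6, ae_restrict_mem hΩo.measurableSet] with x hx hxΩ
    rw [hx, cellFun, dif_pos (mem_image_of_mem _ hxΩ)]
  have e1 : ‖v.fst - cellToL2 (Ω := Ω) η F (fun k => a k)‖ₑ ^ 2 ≤
      ∫⁻ x, ‖φ x - a (cellIndex η x)‖ₑ ^ 2 := by
    rw [Lp.enorm_def, eLpNorm_two_sq]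
    refine le_trans (le_of_eq (lintegral_congr_ae ?_)) (setLIntegral_le_lintegral Ω _)
    filter_upwards [Lp.coeFn_sub v.fst (cellToL2 (Ω := Ω) η F fun k => a k), h4, hae]
      with x b1 b2 b3
    rw [b1, Pi.sub_apply, b2, b3]
  have e2 : ∫⁻ x, ‖gradient φ x‖ₑ ^ 2 = ‖v.snd‖ₑ ^ 2 := by
    have h6 : ∫⁻ x in Ω, ‖v.snd x‖ₑ ^ 2 = ∫⁻ x in Ω, ‖gradient φ x‖ₑ ^ 2 :=
      lintegral_congr_ae (h5.mono fun x hx => by simp only [hx])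
    rw [Lp.enorm_def, eLpNorm_two_sq, h6]
    refine (setLIntegral_eq_of_support_subset ?_).symm
    intro x hx
    by_contra hxΩ
    exact hx (by simp [gradient_eq_zero_of_notMem_tsupport fun h => hxΩ (h3 h)])
  have e3 := e1.trans (lintegral_sub_cell_average_le hd hη0 h1 h2)
  rw [hconst, e2, ENNReal.ofReal_pow hτ.le, ← mul_pow] at e3
  have e4 := (ENNReal.pow_le_pow_left_iff two_ne_zero).1 e3
  rw [← ofReal_norm, ← ofReal_norm, ← ENNReal.ofReal_mul hτ.le] at e4
  exact (ENNReal.ofReal_le_ofReal_iff (by positivity)).1 e4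

end FiniteRankApproximation

/-! ### Elementary facts on states and costs -/

section Basic

variable {d : ℕ} {Ω : Set (Eucl d)} {V : Submodule ℝ (GradPair Ω)}

/-- The reference solution that turns stability into an a priori bound. -/
theorem solvesVI_zero : SolvesVI V 0 0 := by
  refine ⟨V.zero_mem, fun v _ => ?_⟩
  have h1 : bilin (0 : GradPair Ω) (v - 0) = 0 := inner_zero_left _
  rw [inner_zero_left, h1, normL1_zero]
  linarith [normL1_nonneg v]

theorem le_reduced (ν : ℝ) (yd ud u : L2 Ω) : ν / 2 * ‖u - ud‖ ^ 2 ≤ reduced V ν yd ud u := by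
  unfold reduced cost
  have : 0 ≤ 1 / 2 * ‖(solOp V u).fst - yd‖ ^ 2 := by positivity
  linarith

end Basic

/-! ### Stability of states and existence of discrete minimizers -/

section States

variable {d : ℕ} {Ω : Set (Eucl d)} [IsFiniteMeasure (volume.restrict Ω)]
  {V : Submodule ℝ (GradPair Ω)} {C : ℝ}

theorem norm_solOp_fst_sub_le (hV : IsClosed (V : Set (GradPair Ω))) (hC : 0 < C)
    (hP : ∀ v ∈ V, ‖v.fst‖ ≤ C * ‖v.snd‖) {u w : L2 Ω} {κ : ℝ} (hκ : 0 ≤ κ)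
    (h : ∀ v ∈ V, ⟪u - w, v.fst⟫ ≤ κ * ‖v.snd‖) :
    ‖(solOp V u).fst - (solOp V w).fst‖ ≤ C * κ := by
  have hu := solvesVI_solOp hV hP u
  have hw := solvesVI_solOp hV hP w
  have h1 := norm_snd_sub_le_of_inner_le hu hw hκ h
  have h2 := hP _ (V.sub_mem hu.1 hw.1)
  exact h2.trans (mul_le_mul_of_nonneg_left h1 hC.le)

theorem norm_solOp_fst_sub_le_norm (hV : IsClosed (V : Set (GradPair Ω))) (hC : 0 < C)
    (hP : ∀ v ∈ V, ‖v.fst‖ ≤ C * ‖v.snd‖) (u w : L2 Ω) :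
    ‖(solOp V u).fst - (solOp V w).fst‖ ≤ C ^ 2 * ‖u - w‖ := by
  have h := norm_solOp_fst_sub_le hV hC hP (u := u) (w := w) (κ := C * ‖u - w‖) (by positivity)
    fun v hv => by
      have h1 := real_inner_le_norm (u - w) v.fst
      have h2 := mul_le_mul_of_nonneg_left (hP v hv) (norm_nonneg (u - w))
      linarith
  exact h.trans (le_of_eq (by ring))

theorem norm_solOp_fst_le (hV : IsClosed (V : Set (GradPair Ω))) (hC : 0 < C)
    (hP : ∀ v ∈ V, ‖v.fst‖ ≤ C * ‖v.snd‖) (u : L2 Ω) :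
    ‖(solOp V u).fst‖ ≤ C ^ 2 * ‖u‖ := by
  have hu := solvesVI_solOp hV hP u
  have h1 := norm_snd_sub_le_of_inner_le hu solvesVI_zero (κ := C * ‖u‖) (by positivity)
    fun v hv => by
      have h1 := real_inner_le_norm u v.fst
      have h2 := mul_le_mul_of_nonneg_left (hP v hv) (norm_nonneg u)
      rw [sub_zero]
      linarith
  rw [sub_zero] at h1
  have h2 := hP _ hu.1
  nlinarith

theorem continuous_solOp_fst (hV : IsClosed (V : Set (GradPair Ω))) (hC : 0 < C)
    (hP : ∀ v ∈ V, ‖v.fst‖ ≤ C * ‖v.snd‖) : Continuous fun u => (solOp V u).fst :=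
  (LipschitzWith.of_dist_le_mul (K := Real.toNNReal (C ^ 2)) fun u w => by
    rw [dist_eq_norm, dist_eq_norm, Real.coe_toNNReal _ (by positivity)]
    exact norm_solOp_fst_sub_le_norm hV hC hP u w).continuous

theorem norm_sub_starProjection_le_norm {E : Type*} [NormedAddCommGroup E] [InnerProductSpace ℝ E]
    (X : Submodule ℝ E) [X.HasOrthogonalProjection] (y : E) :
    ‖y - X.starProjection y‖ ≤ ‖y‖ := by
  simpa using norm_sub_starProjection_le X y X.zero_mem

/-- Replacing the control by a projection onto a space that approximates the states well. -/
theorem norm_solOp_fst_sub_starProjection_le (hV : IsClosed (V : Set (GradPair Ω))) (hC : 0 < C)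
    (hP : ∀ v ∈ V, ‖v.fst‖ ≤ C * ‖v.snd‖) (X : Submodule ℝ (L2 Ω)) [FiniteDimensional ℝ X]
    {τ : ℝ} (hτ : 0 ≤ τ) (hX : ∀ v ∈ V, ‖v.fst - X.starProjection v.fst‖ ≤ τ * ‖v.snd‖)
    (u : L2 Ω) :
    ‖(solOp V u).fst - (solOp V (X.starProjection u)).fst‖ ≤ C * (τ * ‖u‖) := by
  refine norm_solOp_fst_sub_le hV hC hP (by positivity) fun v hv => ?_
  -- Orthogonality lets the projection of `v.fst` be subtracted for free, so the approximation error
  -- of `v` rather than of `u` appears.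
  have h0 : ⟪u - X.starProjection u, X.starProjection v.fst⟫ = 0 :=
    Submodule.inner_left_of_mem_orthogonal (Submodule.starProjection_apply_mem X _)
      (Submodule.sub_starProjection_mem_orthogonal u)
  have h1 : ⟪u - X.starProjection u, v.fst⟫ =
      ⟪u - X.starProjection u, v.fst - X.starProjection v.fst⟫ := by
    rw [inner_sub_right, h0, sub_zero]
  rw [h1]
  refine (real_inner_le_norm _ _).trans ?_
  refine (mul_le_mul (norm_sub_starProjection_le_norm X u) (hX v hv) (norm_nonneg _)
    (norm_nonneg _)).trans (le_of_eq (by ring))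

theorem continuous_reduced (hV : IsClosed (V : Set (GradPair Ω))) (hC : 0 < C)
    (hP : ∀ v ∈ V, ‖v.fst‖ ≤ C * ‖v.snd‖) (ν : ℝ) (yd ud : L2 Ω) :
    Continuous (reduced V ν yd ud) := by
  have h := continuous_solOp_fst hV hC hP
  exact (continuous_const.mul ((h.sub continuous_const).norm.pow 2)).add
    (continuous_const.mul ((continuous_id.sub continuous_const).norm.pow 2))

/-- The localized problem has a solution if the states lie in a finite-dimensional space. -/
theorem exists_solvesLocalized (hV : IsClosed (V : Set (GradPair Ω))) (hC : 0 < C)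
    (hP : ∀ v ∈ V, ‖v.fst‖ ≤ C * ‖v.snd‖) (W : Submodule ℝ (L2 Ω)) [FiniteDimensional ℝ W]
    (hW : ∀ v ∈ V, v.fst ∈ W) {ν : ℝ} (hν : 0 ≤ ν) (yd ud ubar : L2 Ω) {ε : ℝ} (hε : 0 ≤ ε) :
    ∃ u, SolvesLocalized (reduced V ν yd ud) ubar ε u := by
  -- Including `ubar` and `ud` makes the projection nonexpansive towards both: it stays in the ball
  -- and does not increase the control cost.
  set X : Submodule ℝ (L2 Ω) := W ⊔ Submodule.span ℝ {ubar, ud} with hXdef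
  have : FiniteDimensional ℝ (Submodule.span ℝ {ubar, ud}) :=
    FiniteDimensional.span_of_finite ℝ (Set.toFinite _)
  have hX : FiniteDimensional ℝ X := inferInstance
  have hWX : ∀ v ∈ V, v.fst ∈ X := fun v hv => Submodule.mem_sup_left (hW v hv)
  have hub : ubar ∈ X := Submodule.mem_sup_right (Submodule.subset_span (by simp))
  have hud : ud ∈ X := Submodule.mem_sup_right (Submodule.subset_span (by simp))
  have hproj : ∀ {x : L2 Ω}, x ∈ X → ∀ u, ‖X.starProjection u - x‖ ≤ ‖u - x‖ := by
    intro x hx u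
    have h1 : X.starProjection u - x = X.starProjection (u - x) := by
      rw [map_sub, Submodule.starProjection_eq_self_iff.2 hx]
    rw [h1]
    exact Submodule.norm_starProjection_apply_le X _
  have hstate : ∀ u, (solOp V (X.starProjection u)).fst = (solOp V u).fst := by
    intro u
    -- Elements of `V` have first component in `X`, so the approximation estimate holds with `τ = 0`
    -- and the projected control has the same state.
    have h := norm_solOp_fst_sub_starProjection_le hV hC hP X le_rfl (fun v hv => by
      rw [Submodule.starProjection_eq_self_iff.2 (hWX v hv)]
      simp) u
    rw [zero_mul, mul_zero] at h
    exact (sub_eq_zero.1 (norm_eq_zero.1 (le_antisymm h (norm_nonneg _)))).symm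
  have hcomp : IsCompact (Metric.closedBall (⟨ubar, hub⟩ : X) ε) := by
    have := FiniteDimensional.proper_real X
    exact isCompact_closedBall _ _
  obtain ⟨x, hx, hmin⟩ := hcomp.exists_isMinOn ⟨⟨ubar, hub⟩, Metric.mem_closedBall_self hε⟩
    ((continuous_reduced hV hC hP ν yd ud).comp continuous_subtype_val).continuousOn
  refine ⟨x, hx, fun u hu => ?_⟩
  have h1 : (⟨X.starProjection u, Submodule.starProjection_apply_mem X u⟩ : X) ∈
      Metric.closedBall (⟨ubar, hub⟩ : X) ε := by
    rw [mem_closedBall_iff_norm] at hu ⊢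
    exact (hproj hub u).trans hu
  have h2 : reduced V ν yd ud x ≤ reduced V ν yd ud (X.starProjection u) := hmin h1
  refine h2.trans ?_
  change reduced V ν yd ud (X.starProjection u) ≤ reduced V ν yd ud u
  unfold reduced cost
  rw [hstate]
  have := hproj hud u
  gcongr

theorem exists_forall_reduced_le (hV : IsClosed (V : Set (GradPair Ω))) (hC : 0 < C)
    (hP : ∀ v ∈ V, ‖v.fst‖ ≤ C * ‖v.snd‖) (W : Submodule ℝ (L2 Ω)) [FiniteDimensional ℝ W]
    (hW : ∀ v ∈ V, v.fst ∈ W) {ν : ℝ} (hν : 0 < ν) (yd ud : L2 Ω) :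
    ∃ u, ∀ w, reduced V ν yd ud u ≤ reduced V ν yd ud w := by
  set f := reduced V ν yd ud with hf
  have hf0 : 0 ≤ f ud := le_trans (by positivity) (le_reduced ν yd ud ud)
  -- Outside this ball around `ud` the control cost alone is at least `f ud`, so a minimizer over
  -- the ball is global.
  set R := Real.sqrt (2 * f ud / ν) with hR
  obtain ⟨u, -, hu⟩ := exists_solvesLocalized hV hC hP W hW hν.le yd ud ud (ε := R)
    (Real.sqrt_nonneg _)
  refine ⟨u, fun w => ?_⟩
  by_cases hw : w ∈ Metric.closedBall ud R
  · exact hu hw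
  · rw [mem_closedBall_iff_norm, not_le] at hw
    have h1 := hu (Metric.mem_closedBall_self (Real.sqrt_nonneg _) : ud ∈ Metric.closedBall ud R)
    have h2 := le_reduced (V := V) ν yd ud w
    have h3 : R ^ 2 ≤ ‖w - ud‖ ^ 2 := pow_le_pow_left₀ (Real.sqrt_nonneg _) hw.le 2
    have h4 : ν / 2 * R ^ 2 = f ud := by
      rw [hR, Real.sq_sqrt (by positivity)]
      field_simp
    have h5 := mul_le_mul_of_nonneg_left h3 (half_pos hν).le
    exact (show f u ≤ f ud from h1).trans (by linarith)

end States

/-! ### Convergence of states and reduced objectives -/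

section Convergence

variable {d : ℕ} {Ω : Set (Eucl d)} {ι : Type*} {l : Filter ι} {T : ι → Mesh Ω}

theorem Mesh.space_le (T : Mesh Ω) : T.space ≤ H10 Ω := fun _ hv => hv.1

theorem eventually_norm_solOp_sub_lt (hd : 1 ≤ d) (hΩo : IsOpen Ω) (hΩ : Bornology.IsBounded Ω)
    (hTs : ShapeRegular T) (hTw : Tendsto (fun i => (T i).width) l (𝓝 0)) (u : L2 Ω) {η : ℝ}
    (hη : 0 < η) :
    ∀ᶠ i in l, ‖(solOp (T i).space u).fst - (solOp (H10 Ω) u).fst‖ < η := by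
  have := isFiniteMeasure_restrict hΩ
  obtain ⟨C, hC, hP⟩ := exists_poincare hd hΩ
  have hy := solvesVI_solOp isClosed_H10 hP u
  set y := solOp (H10 Ω) u with hydef
  -- Quasi-optimality doubles the energy gap and Poincaré costs a factor `C`, hence this tolerance.
  obtain ⟨r, hr, hE⟩ := Metric.continuous_iff.1 (continuous_energy u) y
    ((η / C) ^ 2 / 2) (by positivity)
  filter_upwards [eventually_exists_mem_space_near hd hΩo hΩ hTs hTw hy.1 hr] with i ⟨v, hv, hvy⟩
  have hz := solvesVI_solOp ((T i).isClosed_space hΩo hΩ)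
    (fun v hv => hP v ((T i).space_le hv)) u
  have h1 := norm_snd_sub_sq_le_energy (T i).space_le hy hz hv
  have h2 := hE v (by rwa [dist_eq_norm])
  rw [Real.dist_eq] at h2
  have h3 := (abs_lt.1 h2).2
  have h4 : ‖(solOp (T i).space u - y).snd‖ < η / C :=
    lt_of_pow_lt_pow_left₀ 2 (by positivity) (by linarith)
  have h5 := hP _ ((H10 Ω).sub_mem ((T i).space_le hz.1) hy.1)
  rw [lt_div_iff₀ hC] at h4
  exact h5.trans_lt (by linarith)

/-- The discrete states converge in `L²(Ω)`, uniformly for controls in bounded sets. -/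
theorem eventually_forall_norm_solOp_sub_lt (hd : 1 ≤ d) (hΩo : IsOpen Ω)
    (hΩ : Bornology.IsBounded Ω) (hTs : ShapeRegular T)
    (hTw : Tendsto (fun i => (T i).width) l (𝓝 0)) (R : ℝ) {η : ℝ} (hη : 0 < η) :
    ∀ᶠ i in l, ∀ u : L2 Ω, ‖u‖ ≤ R →
      ‖(solOp (T i).space u).fst - (solOp (H10 Ω) u).fst‖ < η := by
  have := isFiniteMeasure_restrict hΩ
  obtain ⟨C, hC, hP⟩ := exists_poincare hd hΩ
  -- Projecting the control and moving it to the net each cost `η / 8`, in the discrete and in the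
  -- continuous state, leaving room for the error at the net points.
  set τ := η / 8 / (C * (|R| + 1)) with hτ
  have hτ0 : 0 < τ := by positivity
  set r := η / 8 / C ^ 2 with hr
  have hr0 : 0 < r := by positivity
  obtain ⟨X, hXf, hX⟩ := exists_finiteDimensional_approx hd hΩo hΩ hτ0
  have hcomp : IsCompact (Metric.closedBall (0 : X) R) := by
    have := FiniteDimensional.proper_real X
    exact isCompact_closedBall _ _
  obtain ⟨t, -, htf, htc⟩ := hcomp.finite_cover_balls hr0
  have hball : ∀ u : L2 Ω, ‖u‖ ≤ R → ∃ x ∈ t, ‖X.starProjection u - x‖ < r := by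
    intro u hu
    have h1 : (⟨X.starProjection u, Submodule.starProjection_apply_mem X u⟩ : X) ∈
        Metric.closedBall (0 : X) R := by
      rw [mem_closedBall_zero_iff]
      exact (Submodule.norm_starProjection_apply_le X u).trans hu
    obtain ⟨x, hx, hxr⟩ := mem_iUnion₂.1 (htc h1)
    exact ⟨x, hx, mem_ball_iff_norm.1 hxr⟩
  -- Only the Poincaré and approximation constants of `H10 Ω` enter, so the bound is independent of
  -- the mesh.
  have hstep : ∀ V : Submodule ℝ (GradPair Ω), V ≤ H10 Ω → IsClosed (V : Set (GradPair Ω)) →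
      ∀ u : L2 Ω, ‖u‖ ≤ R → ∀ x : L2 Ω, ‖X.starProjection u - x‖ < r →
      ‖(solOp V u).fst - (solOp V x).fst‖ ≤ η / 4 := by
    intro V hVH hV u hu x hx
    have hPV : ∀ v ∈ V, ‖v.fst‖ ≤ C * ‖v.snd‖ := fun v hv => hP v (hVH hv)
    have h1 := norm_solOp_fst_sub_starProjection_le hV hC hPV X hτ0.le
      (fun v hv => hX v (hVH hv)) u
    have h2 := norm_solOp_fst_sub_le_norm hV hC hPV (X.starProjection u) x
    have h3 : C * (τ * ‖u‖) ≤ η / 8 := by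
      have h4 : ‖u‖ ≤ |R| + 1 := hu.trans ((le_abs_self R).trans (by linarith))
      calc C * (τ * ‖u‖) ≤ C * (τ * (|R| + 1)) := by gcongr
        _ = η / 8 := by rw [hτ]; field_simp
    have h5 : C ^ 2 * ‖X.starProjection u - x‖ ≤ η / 8 := by
      calc C ^ 2 * ‖X.starProjection u - x‖ ≤ C ^ 2 * r := by gcongr
        _ = η / 8 := by rw [hr]; field_simp
    have h6 := norm_sub_le_norm_sub_add_norm_sub (solOp V u).fst
      (solOp V (X.starProjection u)).fst (solOp V x).fst
    linarith
  have hall : ∀ᶠ i in l, ∀ x ∈ t,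
      ‖(solOp (T i).space (x : L2 Ω)).fst - (solOp (H10 Ω) (x : L2 Ω)).fst‖ < η / 4 :=
    (eventually_all_finite htf).2 fun x _ =>
      eventually_norm_solOp_sub_lt hd hΩo hΩ hTs hTw x (by positivity)
  filter_upwards [hall] with i hi u hu
  obtain ⟨x, hxt, hx⟩ := hball u hu
  have h1 := hstep _ (T i).space_le ((T i).isClosed_space hΩo hΩ) u hu x hx
  have h2 := hstep _ le_rfl isClosed_H10 u hu x hx
  have h3 := hi x hxt
  have h4 := norm_sub_le_norm_sub_add_norm_sub (solOp (T i).space u).fst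
    (solOp (T i).space (x : L2 Ω)).fst (solOp (H10 Ω) u).fst
  have h5 := norm_sub_le_norm_sub_add_norm_sub (solOp (T i).space (x : L2 Ω)).fst
    (solOp (H10 Ω) (x : L2 Ω)).fst (solOp (H10 Ω) u).fst
  rw [norm_sub_rev] at h2
  linarith

/-- The discrete reduced objectives converge uniformly on bounded sets. -/
theorem eventually_forall_abs_reduced_sub_lt (hd : 1 ≤ d) (hΩo : IsOpen Ω)
    (hΩ : Bornology.IsBounded Ω) (hTs : ShapeRegular T)
    (hTw : Tendsto (fun i => (T i).width) l (𝓝 0)) (ν : ℝ) (yd ud : L2 Ω) (R : ℝ) {η : ℝ}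
    (hη : 0 < η) :
    ∀ᶠ i in l, ∀ u : L2 Ω, ‖u‖ ≤ R →
      |reduced (T i).space ν yd ud u - reduced (H10 Ω) ν yd ud u| < η := by
  have := isFiniteMeasure_restrict hΩ
  obtain ⟨C, hC, hP⟩ := exists_poincare hd hΩ
  set M := C ^ 2 * |R| + ‖yd‖ + 1 with hM
  have hM0 : 0 < M := by positivity
  filter_upwards [eventually_forall_norm_solOp_sub_lt hd hΩo hΩ hTs hTw R (div_pos hη hM0)]
    with i hi u hu
  have h1 := hi u hu
  have hu' : ‖u‖ ≤ |R| := hu.trans (le_abs_self R)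
  have hb : ∀ V : Submodule ℝ (GradPair Ω), V ≤ H10 Ω → IsClosed (V : Set (GradPair Ω)) →
      ‖(solOp V u).fst - yd‖ ≤ M := by
    intro V hVH hV
    have h2 := norm_solOp_fst_le hV hC (fun v hv => hP v (hVH hv)) u
    have h3 := norm_sub_le (solOp V u).fst yd
    have h4 : C ^ 2 * ‖u‖ ≤ C ^ 2 * |R| := by gcongr
    linarith
  have h2 := hb _ (T i).space_le ((T i).isClosed_space hΩo hΩ)
  have h3 := hb _ le_rfl isClosed_H10
  set a := ‖(solOp (T i).space u).fst - yd‖ with ha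
  set b := ‖(solOp (H10 Ω) u).fst - yd‖ with hbdef
  have h4 : |a - b| < η / M := by
    refine (abs_norm_sub_norm_le _ _).trans_lt ?_
    rwa [sub_sub_sub_cancel_right]
  have h5 : reduced (T i).space ν yd ud u - reduced (H10 Ω) ν yd ud u
      = 1 / 2 * ((a - b) * (a + b)) := by
    unfold reduced cost
    rw [← ha, ← hbdef]
    ring
  have ha0 : 0 ≤ a := norm_nonneg _
  have hb0 : 0 ≤ b := norm_nonneg _
  rw [h5, abs_mul, abs_mul, abs_of_nonneg (add_nonneg ha0 hb0),
    abs_of_pos (by norm_num : (0 : ℝ) < 1 / 2)]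
  have h6 : |a - b| * (a + b) ≤ |a - b| * (2 * M) :=
    mul_le_mul_of_nonneg_left (by linarith) (abs_nonneg _)
  rw [lt_div_iff₀ hM0] at h4
  linarith

end Convergence

end VIControl

end

/-! ### Convergence of local solutions -/

theorem lemma4p2 {d : ℕ} (hd1 : 1 ≤ d) (hd3 : d ≤ 3)
    -- a bounded domain; it is polyhedral by the existence of the meshes below
    (Ω : Set (Eucl d)) (hΩo : IsOpen Ω) (hΩc : IsConnected Ω) (hΩb : Bornology.IsBounded Ω)
    (ν : ℝ) (hν : 0 < ν) (yd ud : L2 Ω) (hud : MemLp ud ⊤ (volume.restrict Ω))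
    -- a shape-regular, quasi-uniform family of meshes whose widths tend to zero
    {ι : Type*} (l : Filter ι) (T : ι → Mesh Ω) (hTs : ShapeRegular T) (hTq : QuasiUniform T)
    (hTw : Tendsto (fun i => (T i).width) l (𝓝 0))
    (ubar : L2 Ω) (ε δ : ℝ) (hε : 0 < ε) (hδ : 0 < δ)
    (hqg : QuadraticGrowth (reduced (H10 Ω) ν yd ud) ubar ε δ) :
    -- every localized discrete problem has a global minimizer
    (∀ i, ∃ u : L2 Ω, SolvesLocalized (reduced (T i).space ν yd ud) ubar ε u) ∧
    -- there are local solutions of the discrete problems that converge to `ubar` in `L²(Ω)` and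
    -- are, for small mesh widths, global minimizers of the localized problems
    ∃ u : ι → L2 Ω,
      (∀ i, IsLocalMin (reduced (T i).space ν yd ud) (u i)) ∧
      (∀ᶠ i in l, SolvesLocalized (reduced (T i).space ν yd ud) ubar ε (u i)) ∧
      Tendsto u l (𝓝 ubar) := by
  have := isFiniteMeasure_restrict hΩb
  obtain ⟨C, hC, hP⟩ := exists_poincare hd1 hΩb
  have hcl : ∀ i, IsClosed ((T i).space : Set (GradPair Ω)) := fun i => (T i).isClosed_space hΩo hΩb
  have hPi : ∀ i, ∀ v ∈ (T i).space, ‖v.fst‖ ≤ C * ‖v.snd‖ := fun i v hv =>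
    hP v ((T i).space_le hv)
  have hfd : ∀ i, FiniteDimensional ℝ (piecewiseAffine hΩo hΩb (T i).elements) := fun i =>
    finiteDimensional_piecewiseAffine hΩo hΩb _ (T i).subset_cover
  have hpw : ∀ i, ∀ v ∈ (T i).space, v.fst ∈ piecewiseAffine hΩo hΩb (T i).elements :=
    fun i v hv => (((T i).mem_space_iff hΩo hΩb v).1 hv).2
  have hloc : ∀ i, ∃ u : L2 Ω, SolvesLocalized (reduced (T i).space ν yd ud) ubar ε u := fun i =>
    have := hfd i
    exists_solvesLocalized (hcl i) hC (hPi i) _ (hpw i) hν.le yd ud ubar hε.le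
  have hglob : ∀ i, ∃ u : L2 Ω, ∀ w,
      reduced (T i).space ν yd ud u ≤ reduced (T i).space ν yd ud w := fun i =>
    have := hfd i
    exists_forall_reduced_le (hcl i) hC (hPi i) _ (hpw i) hν yd ud
  refine ⟨hloc, ?_⟩
  choose v hv using hloc
  choose g hg using hglob
  have hconv : Tendsto v l (𝓝 ubar) := by
    rw [Metric.tendsto_nhds]
    intro η hη
    -- The objective error occurs twice, at `v i` and at `ubar`, so half of `δ * η ^ 2` is allowed
    -- for each; the radius contains the whole localization ball.
    filter_upwards [eventually_forall_abs_reduced_sub_lt hd1 hΩo hΩb hTs hTw ν yd ud (‖ubar‖ + ε)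
      (show 0 < δ * η ^ 2 / 2 by positivity)] with i hi
    have hvb : ‖v i - ubar‖ ≤ ε := mem_closedBall_iff_norm.1 (hv i).1
    have h1 := abs_lt.1 (hi (v i) (by
      have := norm_le_norm_add_norm_sub ubar (v i)
      rw [norm_sub_rev] at this
      linarith))
    have h2 := abs_lt.1 (hi ubar (by linarith))
    have h3 : reduced (T i).space ν yd ud (v i) ≤ reduced (T i).space ν yd ud ubar :=
      (hv i).2 (Metric.mem_closedBall_self hε.le)
    have h4 := hqg (v i) (hv i).1
    have h5 : δ * ‖v i - ubar‖ ^ 2 < δ * η ^ 2 := by linarith [h1.1, h2.2]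
    rw [dist_eq_norm]
    exact lt_of_pow_lt_pow_left₀ 2 hη.le (lt_of_mul_lt_mul_left h5 hδ.le)
  have hev : ∀ᶠ i in l, v i ∈ Metric.ball ubar ε := hconv (Metric.ball_mem_nhds ubar hε)
  classical
  have heq : ∀ᶠ i in l, v i = if v i ∈ Metric.ball ubar ε then v i else g i :=
    hev.mono fun i hi => (if_pos hi).symm
  -- A localized minimizer on the boundary of the ball need not be a local solution. On the meshes
  -- where this happens a global minimizer of the discrete problem is used; eventually none remain.
  refine ⟨fun i => if v i ∈ Metric.ball ubar ε then v i else g i, fun i => ?_, ?_,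
    hconv.congr' heq⟩
  · dsimp only
    split_ifs with h
    · exact (hv i).2.isLocalMin (mem_of_superset (Metric.isOpen_ball.mem_nhds h)
        Metric.ball_subset_closedBall)
    · exact Eventually.of_forall (hg i)
  · filter_upwards [heq] with i hi
    rw [← hi]
    exact hv i
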